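/- Let $J=\begin{pmatrix}0&-I_n\\ I_n&0\end{pmatrix}$, and let $U\subset\mathbb R^{2n}$ be a compact convex region with $0$ in its interior whose boundary $\Sigma=\partial U$ is a $C^3$ hypersurface. Let $j$ be the gauge function of $U$ and $H_\alpha=j^\alpha$. Let $0<r\le R$ and suppose that $\Sigma$ is $(r,R)$-pinched, i.e. $$|v|^2R^{-2}\le \tfrac12 H_2''(x)v\cdot v\le |v|^2r^{-2}\qquad\text{for all }x\in\Sigma,\ v\in\mathbb R^{2n}.$$ Let $(\tau,y)$ be a closed characteristic on $\Sigma$, i.e. $\tau>0$ and $y:\mathbb R\to\Sigma$ solves $\dot y=JN_\Sigma(y)$, $y(\tau)=y(0)$, where $N_\Sigma(x)$ is the outward normal at $x$ normalized by $N_\Sigma(x)\cdot x=1$ ($\tau$ need not be the minimal period). Its action is $A(\tau,y)=\frac12\int_0^\tau Jy\cdot\dot y\,dt$. Let $\alpha\in(1,2)$. There is exactly one solution $x$ of $\dot x=JH_\alpha'(x)$, $x(1)=x(0)$ of the form $x(t)=c\,y(\tau t)$ with a constant $c>0$; put $u=\dot x$. On $L^2_0=\{v\in L^2(\mathbb R/\mathbb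 Z,\mathbb R^{2n}) : \int_0^1v\,dt=0\}$ consider the quadratic form $$Q(v,v)=\int_0^1\bigl(Jv\cdot Mv+(H_\alpha^*)''(-Ju)Jv\cdot Jv\bigr)dt,$$ where $Mv$ is the primitive of $v$ with mean value zero and $H_\alpha^*(p)=\sup_x(x\cdot p-H_\alpha(x))$. The index $i(y)$ is the dimension of the negative subspace of $Q$ (the largest dimension of a subspace on which $Q$ is negative definite), and the nullity $\nu(y)$ is the dimension of the kernel of $Q$. Then $i(y)$ and $\nu(y)$ are finite, and for every integer $k$, $$A(\tau,y)>k\pi R^2\ \Longrightarrow\ i(y)\ge 2nk,$$ $$A(\tau,y)<k\pi r^2\ \Longrightarrow\ i(y)+\nu(y)\le 2n(k-1)-1.$$ -/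

import Mathlib

open MeasureTheory Set
open scoped Topology InnerProductSpace Gradient

noncomputable section

namespace ClosedChar

/-- The phase space `ℝ²ⁿ = ℝⁿ × ℝⁿ` with its Euclidean structure. -/
abbrev Phase (n : ℕ) : Type := EuclideanSpace ℝ (Fin n ⊕ Fin n)

/-- The standard complex structure, with block matrix `(0, -I; I, 0)`. -/
def J (n : ℕ) : Phase n →L[ℝ] Phase n :=
  Matrix.toEuclideanCLM (n := Fin n ⊕ Fin n) (𝕜 := ℝ) (Matrix.J (Fin n) ℝ)

/-- The second derivative `F''(x) v · w`. -/
def hess {n : ℕ} (F : Phase n → ℝ) (x v w : Phase n) : ℝ :=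
  fderiv ℝ (fderiv ℝ F) x v w

/-- `S` is an (embedded) hypersurface of class `C³`: near each of its points it is the zero set
of a `C³` function whose differential does not vanish at the point. -/
def IsC3Hypersurface {n : ℕ} (S : Set (Phase n)) : Prop :=
  ∀ x ∈ S, ∃ (W : Set (Phase n)) (f : Phase n → ℝ), IsOpen W ∧ x ∈ W ∧
    ContDiffOn ℝ 3 f W ∧ fderiv ℝ f x ≠ 0 ∧ S ∩ W = {z ∈ W | f z = 0}

/-- The Hamiltonian `H_α = j ^ α`, where `j` is the gauge function of the region `U`. -/
def ham {n : ℕ} (U : Set (Phase n)) (α : ℝ) (x : Phase n) : ℝ :=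
  gauge U x ^ α

/-- The boundary of `U` is a `C³` hypersurface bounding the compact convex region `U`, which
contains `0` in its interior, and it is `(r, R)`-pinched. -/
structure IsPinched {n : ℕ} (U : Set (Phase n)) (r R : ℝ) : Prop where
  isCompact : IsCompact U
  convex : Convex ℝ U
  zero_mem : (0 : Phase n) ∈ interior U
  smooth : IsC3Hypersurface (frontier U)
  r_pos : 0 < r
  r_le : r ≤ R
  lower : ∀ x ∈ frontier U, ∀ v : Phase n, ‖v‖ ^ 2 / R ^ 2 ≤ 1 / 2 * hess (ham U 2) x v v
  upper : ∀ x ∈ frontier U, ∀ v : Phase n, 1 / 2 * hess (ham U 2) x v v ≤ ‖v‖ ^ 2 / r ^ 2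

/-- `N` is the outward normal vector of the convex region `U` at the boundary point `x`
normalized by `N · x = 1`. -/
def IsOutwardNormal {n : ℕ} (U : Set (Phase n)) (x N : Phase n) : Prop :=
  (∀ z ∈ U, ⟪N, z - x⟫_ℝ ≤ 0) ∧ ⟪N, x⟫_ℝ = 1

/-- `(τ, y)` is a closed characteristic on the boundary of `U`: `y' = J N(y)`, `y(τ) = y(0)`.
The period `τ > 0` need not be minimal, so iterates are included. -/
structure IsClosedChar {n : ℕ} (U : Set (Phase n)) (τ : ℝ) (y : ℝ → Phase n) : Prop where
  pos : 0 < τ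
  mem : ∀ t, y t ∈ frontier U
  eqn : ∀ t, ∃ N, IsOutwardNormal U (y t) N ∧ HasDerivAt y (J n N) t
  closed : y τ = y 0

/-- The action `A(τ, y) = ½ ∫₀^τ J y · y' dt`. -/
def action {n : ℕ} (τ : ℝ) (y : ℝ → Phase n) : ℝ :=
  1 / 2 * ∫ t in (0 : ℝ)..τ, ⟪J n (y t), deriv y t⟫_ℝ

/-- `x` is the solution of the fixed period problem `x' = J H_α'(x)`, `x(1) = x(0)` which
corresponds to the closed characteristic `(τ, y)`: it is a dilate of `y`, run through in
time `1`. -/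
structure IsAssociatedSol {n : ℕ} (U : Set (Phase n)) (α τ : ℝ) (y x : ℝ → Phase n) : Prop where
  eqn : ∀ t, HasDerivAt x (J n (∇ (ham U α) (x t))) t
  closed : x 1 = x 0
  dilate : ∃ c : ℝ, 0 < c ∧ ∀ t, x t = c • y (τ * t)

/-- The Fenchel transform `F*(p) = sup {x · p - F(x)}`. -/
def fenchel {n : ℕ} (F : Phase n → ℝ) (p : Phase n) : ℝ :=
  ⨆ x : Phase n, (⟪x, p⟫_ℝ - F x)

/-- The Hilbert space of square integrable loops `ℝ/ℤ → ℝ²ⁿ`. -/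
abbrev L2 (n : ℕ) : Type := Lp (Phase n) 2 (volume.restrict (Ioc (0 : ℝ) 1))

/-- The subspace `L₀²` of the loops with mean value zero. -/
def L20 (n : ℕ) : Submodule ℝ (L2 n) where
  carrier := {v | ∫ t in Ioc (0 : ℝ) 1, v t = 0}
  zero_mem' := by
    have h : ∫ t in Ioc (0 : ℝ) 1, (0 : L2 n) t = ∫ _t in Ioc (0 : ℝ) 1, (0 : Phase n) :=
      integral_congr_ae (Lp.coeFn_zero _ _ _)
    simpa using h
  add_mem' := by
    intro v w hv hw
    have h := integral_congr_ae (Lp.coeFn_add v w)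
    have h2 := integral_add ((Lp.memLp v).integrable one_le_two)
      ((Lp.memLp w).integrable one_le_two)
    simp only [mem_ofPred_eq] at hv hw ⊢
    rw [h]
    simp only [Pi.add_apply]
    rw [h2, hv, hw, add_zero]
  smul_mem' := by
    intro c v hv
    have h := integral_congr_ae (Lp.coeFn_smul c v)
    simp only [mem_ofPred_eq] at hv ⊢
    rw [h]
    simp only [Pi.smul_apply]
    rw [integral_smul, hv, smul_zero]

/-- The primitive `M v` on `[0, 1]` with mean value zero. -/
def prim {n : ℕ} (v : ℝ → Phase n) (t : ℝ) : Phase n :=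
  (∫ s in (0 : ℝ)..t, v s) - ∫ σ in (0 : ℝ)..1, ∫ s in (0 : ℝ)..σ, v s

/-- The formal Hessian `Q(v, w) = ∫₀¹ (J v · M w + (H_α*)''(-J u) J v · J w) dt` of the dual
action functional at `u`, as a bilinear form on `L₀²`. -/
def dualHess {n : ℕ} (U : Set (Phase n)) (α : ℝ) (u : ℝ → Phase n) (v w : L20 n) : ℝ :=
  ∫ t in (0 : ℝ)..1, (⟪J n ((v : L2 n) t), prim (w : L2 n) t⟫_ℝ +
    hess (fenchel (ham U α)) (-(J n (u t))) (J n ((v : L2 n) t)) (J n ((w : L2 n) t)))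

/-- The index of a symmetric bilinear form: the largest dimension of a subspace on which it is
negative definite. -/
def formIndex {X : Type*} [AddCommGroup X] [Module ℝ X] (B : X → X → ℝ) : ℕ∞ :=
  ⨆ (V : Submodule ℝ X) (_ : ∀ v ∈ V, v ≠ 0 → B v v < 0), Cardinal.toENat (Module.rank ℝ V)

/-- The nullity of a symmetric bilinear form: the dimension of its kernel. -/
def formNullity {X : Type*} [AddCommGroup X] [Module ℝ X] (B : X → X → ℝ) : ℕ∞ :=
  ⨆ (V : Submodule ℝ X) (_ : ∀ v ∈ V, ∀ w, B v w = 0), Cardinal.toENat (Module.rank ℝ V)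

end ClosedChar

end

/-!
Write `w(t) = y(τ t)`, `N` for the normal along `w` and `S = ½ H₂''(w)`; the pinching condition says
`R⁻² ≤ S ≤ r⁻²`. Since `½ ∇H₂` is homogeneous of degree one, `S w = N`, and `w' = τ J N`,
`w'' = τ J S w'`. Along the associated solution `H_α'' = τ (S - (2 - α) N ⊗ N)`. The Hessian of the
Fenchel transform is the inverse of this operator (`hess_fenchel_gradient`), and by the
Sherman–Morrison formula it equals `τ⁻¹ (S⁻¹ + κ w ⊗ w)` with `κ = (2 - α) / (α - 1) > 0`
(`hess_fenchel_ham`). Denote by `Q_κ` the form `∫ (J v · M v + τ⁻¹ (S⁻¹ + κ w ⊗ w) J v · J v)`. All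
this needs the gauge to be of class `C²` near the orbit, which follows from the implicit function
theorem (`IsPinched.contDiffAt_gauge`). The action is `τ / 2`.

Fourier series diagonalise the comparison forms `∫ (J v · M v + b |v|²)`: on the `2n`-dimensional
space of the mode `e^{2πjtJ}` the eigenvalue is `b - 1 / (2πj)`. With `b = r² / τ`, the form is below
`Q_0`, and with `b = R² / τ` it is above `Q_0`. It remains to compare `Q_κ` with `Q_0`, and the gain
or loss comes from the time shifts.

*Upper bound.* Always `Q_0 ≤ Q_κ`. The velocity `e = w'` lies in the kernel of `Q_0`, while
`Q_κ(e, e) = κ τ > 0`. So a subspace on which `Q_κ` is nonpositive does not contain `e`, and adding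
`e` to it gives a subspace, of dimension one higher, on which `Q_0` and hence the comparison form
is nonpositive. Counting the modes with nonpositive eigenvalue yields the bound with the extra `-1`
(`IsFrame.exists_index_nullity`).

*Lower bound.* Let `v = ψ'` be a trigonometric polynomial in the modes `1, …, k`. The term with `κ`
can be removed by a reparametrisation of the time: there are a periodic function `g` and a constant
`m` such that `φ = ψ + g w' + m w` satisfies `w · J φ' = 0`, and then
`Q_κ(φ', φ') = Q_0(v, v) - τ ∫ g'² ≤ Q_0(v, v)` (`frameForm_corrected_le`). Therefore the image of
the `2nk`-dimensional space of trigonometric polynomials under the linear map `v ↦ φ'` is negative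
for `Q_κ` (`IsFrame.le_formIndex`).
-/

namespace ClosedChar

variable {n : ℕ}

/-! ### The gauge function at the boundary -/

section Gauge

variable {U : Set (Phase n)} {r R : ℝ}

theorem IsPinched.mem_nhds (hU : IsPinched U r R) : U ∈ 𝓝 (0 : Phase n) :=
  mem_interior_iff_mem_nhds.1 hU.zero_mem

theorem IsPinched.gauge_eq_one (hU : IsPinched U r R) {x : Phase n} (hx : x ∈ frontier U) :
    gauge U x = 1 :=
  (gauge_eq_one_iff_mem_frontier hU.convex hU.mem_nhds).2 hx

theorem IsPinched.gauge_pos (hU : IsPinched U r R) {x : Phase n} (hx : x ≠ 0) :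
    0 < gauge U x :=
  (_root_.gauge_pos (absorbent_nhds_zero hU.mem_nhds)
    (NormedSpace.isVonNBounded_of_isBounded _ hU.isCompact.isBounded)).2 hx

/-- The linear function given by a normal vector lies below the gauge, since it is at most `1` on
`U`. -/
theorem IsPinched.inner_le_gauge (hU : IsPinched U r R) {x N : Phase n}
    (hN : IsOutwardNormal U x N) (z : Phase n) : ⟪N, z⟫_ℝ ≤ gauge U z := by
  rcases eq_or_ne z 0 with rfl | hz
  · simp
  have hp := hU.gauge_pos hz
  have hmem : (gauge U z)⁻¹ • z ∈ U := by
    have h : (gauge U z)⁻¹ • z ∈ closure U := by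
      rw [← gauge_le_one_iff_mem_closure hU.convex hU.mem_nhds,
        gauge_smul_of_nonneg (inv_nonneg.2 hp.le), smul_eq_mul, inv_mul_cancel₀ hp.ne']
    rwa [hU.isCompact.isClosed.closure_eq] at h
  have h := hN.1 _ hmem
  rw [inner_sub_right, hN.2, inner_smul_right, sub_nonpos, inv_mul_le_iff₀ hp] at h
  linarith

theorem IsPinched.convexOn_gauge (hU : IsPinched U r R) : ConvexOn ℝ univ (gauge U) := by
  refine ⟨convex_univ, fun x _ z _ a b ha hb _ => ?_⟩
  refine (gauge_add_le hU.convex (absorbent_nhds_zero hU.mem_nhds) _ _).trans ?_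
  rw [gauge_smul_of_nonneg ha, gauge_smul_of_nonneg hb]

theorem IsPinched.convexOn_ham (hU : IsPinched U r R) {α : ℝ} (hα : 1 ≤ α) :
    ConvexOn ℝ univ (ham U α) := by
  refine ⟨convex_univ, fun x hx z hz a b ha hb hab => ?_⟩
  have h1 := hU.convexOn_gauge.2 hx hz ha hb hab
  have h2 := (convexOn_rpow hα).2 (mem_Ici.2 (gauge_nonneg (s := U) x))
    (mem_Ici.2 (gauge_nonneg (s := U) z)) ha hb hab
  exact (Real.rpow_le_rpow (gauge_nonneg _) h1 (by linarith)).trans h2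

theorem ham_smul {c : ℝ} (hc : 0 ≤ c) (α : ℝ) (x : Phase n) :
    ham U α (c • x) = c ^ α * ham U α x := by
  unfold ham
  rw [gauge_smul_of_nonneg hc, smul_eq_mul, Real.mul_rpow hc (gauge_nonneg _)]

/-- A normal vector at a point of a smooth boundary is proportional to the differential of a
defining function, so the radial direction is transversal to the boundary. -/
theorem fderiv_apply_self_ne_zero {W : Set (Phase n)} {f : Phase n → ℝ} {x N : Phase n}
    (hU : IsPinched U r R)
    (hW : W ∈ 𝓝 x) (hf : HasStrictFDerivAt f (fderiv ℝ f x) x) (hne : fderiv ℝ f x ≠ 0)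
    (hfW : ∀ z ∈ W, f z = 0 → z ∈ frontier U) (hx : f x = 0) (hN : IsOutwardNormal U x N) :
    fderiv ℝ f x x ≠ 0 := by
  have hext : IsLocalExtrOn (fun z => innerSL ℝ N z) {z | f z = f x} x := by
    refine Or.inr ?_
    filter_upwards [mem_nhdsWithin_of_mem_nhds hW, self_mem_nhdsWithin] with z hz hz'
    have hzU : z ∈ U := hU.isCompact.isClosed.frontier_subset
      (hfW z hz (Eq.trans hz' hx))
    have := hN.1 z hzU
    rw [inner_sub_right] at this
    simpa using this
  obtain ⟨a, b, hab, h⟩ := hext.exists_multipliers_of_hasStrictFDerivAt_1d hf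
    (innerSL ℝ N).hasStrictFDerivAt
  intro h0
  have h1 := DFunLike.congr_fun h x
  simp only [add_apply, smul_apply, h0, innerSL_apply_apply,
    hN.2, smul_eq_mul, mul_zero, mul_one, zero_add, zero_apply] at h1
  subst h1
  rw [zero_smul, add_zero, smul_eq_zero] at h
  rcases h with h | h
  · exact hab (by rw [h]; rfl)
  · exact hne h

/-- The gauge is `C³` at the boundary points: it is the reciprocal of the function
`s(z)` implicitly defined by `s(z) • z ∈ ∂U`. -/
theorem IsPinched.contDiffAt_gauge (hU : IsPinched U r R) {x N : Phase n}
    (hx : x ∈ frontier U) (hN : IsOutwardNormal U x N) : ContDiffAt ℝ 3 (gauge U) x := by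
  obtain ⟨W, f, hWo, hxW, hf, hne, hS⟩ := hU.smooth x hx
  have hWx : W ∈ 𝓝 x := hWo.mem_nhds hxW
  have hfx : ContDiffAt ℝ 3 f x := hf.contDiffAt hWx
  have hfW : ∀ z ∈ W, f z = 0 → z ∈ frontier U := fun z hz h => (hS.symm.subset ⟨hz, h⟩).1
  have hx0 : f x = 0 := (hS.subset ⟨hx, hxW⟩).2
  have htr := fderiv_apply_self_ne_zero hU hWx (hfx.hasStrictFDerivAt (by norm_num)) hne hfW hx0 hN
  set G : Phase n × ℝ → ℝ := fun p => f (p.2 • p.1) with hG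
  have hGc : ContDiffAt ℝ 3 G (x, 1) := by
    have h1 : ContDiffAt ℝ 3 (fun p : Phase n × ℝ => p.2 • p.1) (x, 1) :=
      contDiffAt_snd.smul contDiffAt_fst
    have h2 : ContDiffAt ℝ 3 f ((fun p : Phase n × ℝ => p.2 • p.1) (x, 1)) := by simpa using hfx
    exact ContDiffAt.comp (x, (1 : ℝ)) h2 h1
  have hGd : (fderiv ℝ G (x, 1) ∘L .inr ℝ (Phase n) ℝ) 1 = fderiv ℝ f x x := by
    have h1 : HasFDerivAt G (fderiv ℝ G (x, 1)) (x, (1 : ℝ)) :=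
      (hGc.differentiableAt (by norm_num)).hasFDerivAt
    have h2 : HasDerivAt (fun s : ℝ => (x, s)) ((0 : Phase n), (1 : ℝ)) 1 :=
      (hasDerivAt_const _ _).prodMk (hasDerivAt_id _)
    have h3 := h1.comp_hasDerivAt (1 : ℝ) h2
    have h4 : HasDerivAt (fun s : ℝ => s • x) ((1 : ℝ) • x) 1 := (hasDerivAt_id _).smul_const x
    have h5 : HasFDerivAt f (fderiv ℝ f x) ((1 : ℝ) • x) := by
      simpa using (hfx.differentiableAt (by norm_num)).hasFDerivAt
    have h6 := h5.comp_hasDerivAt (1 : ℝ) h4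
    have := h3.unique h6
    simpa using this
  have hinv : (fderiv ℝ G (x, 1) ∘L .inr ℝ (Phase n) ℝ).IsInvertible := by
    set L := fderiv ℝ G (x, 1) ∘L .inr ℝ (Phase n) ℝ
    refine ⟨ContinuousLinearEquiv.smulLeft (Units.mk0 _ htr), ?_⟩
    ext
    rw [hGd]
    simp [Units.smul_def]
  set s := hGc.implicitFunction (by norm_num) hinv
  have hs1 : s x = 1 := hGc.implicitFunction_apply_self (by norm_num) hinv
  have hsc : ContDiffAt ℝ 3 s x := hGc.contDiffAt_implicitFunction (by norm_num) hinv
  have hse : ∀ᶠ z in 𝓝 x, G (z, s z) = G (x, 1) :=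
    hGc.eventually_apply_implicitFunction (by norm_num) hinv
  have hpos : ∀ᶠ z in 𝓝 x, 0 < s z :=
    hsc.continuousAt.eventually (lt_mem_nhds (by rw [hs1]; norm_num))
  have hmem : ∀ᶠ z in 𝓝 x, s z • z ∈ W := by
    refine (hsc.continuousAt.smul continuousAt_id).eventually_mem ?_
    simpa [hs1] using hWx
  refine (hsc.inv (by rw [hs1]; norm_num)).congr_of_eventuallyEq ?_
  filter_upwards [hse, hpos, hmem] with z h1 h2 h3
  have h4 := hU.gauge_eq_one (hfW _ h3 (by simpa [hG, hx0] using h1))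
  rw [gauge_smul_of_nonneg h2.le, smul_eq_mul] at h4
  exact eq_inv_of_mul_eq_one_right h4

theorem IsPinched.hasGradientAt_gauge (hU : IsPinched U r R) {x N : Phase n}
    (hx : x ∈ frontier U) (hN : IsOutwardNormal U x N) : HasGradientAt (gauge U) N x := by
  have hd := ((hU.contDiffAt_gauge hx hN).differentiableAt (by norm_num)).hasFDerivAt
  have hmin : IsLocalMin (fun z => gauge U z - innerSL ℝ N z) x := by
    refine Filter.Eventually.of_forall fun z => ?_
    have := hU.inner_le_gauge hN z
    simp only [innerSL_apply_apply, hU.gauge_eq_one hx, hN.2]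
    linarith
  have h0 := hmin.hasFDerivAt_eq_zero (hd.sub (innerSL ℝ N).hasFDerivAt)
  rw [hasGradientAt_iff_hasFDerivAt]
  rw [sub_eq_zero] at h0
  rw [h0] at hd
  exact hd

end Gauge

/-! ### The Fenchel transform to second order -/

section Fenchel

variable {F : Phase n → ℝ}

/-- A convex function lies above its tangent hyperplanes, so the supremum in the Fenchel transform
at `∇F(x)` is attained at `x`. -/
theorem fenchel_gradient (hF : ConvexOn ℝ univ F) {x : Phase n} (hx : DifferentiableAt ℝ F x) :
    fenchel F (∇ F x) = ⟪x, ∇ F x⟫_ℝ - F x := by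
  have key : ∀ z, ⟪z, ∇ F x⟫_ℝ - F z ≤ ⟪x, ∇ F x⟫_ℝ - F x := by
    intro z
    -- along the segment from `x` to `z` the difference quotient of `F` dominates the derivative
    have hd : HasDerivAt (fun t : ℝ => F (x + t • (z - x))) (⟪∇ F x, z - x⟫_ℝ) 0 := by
      have h1 : HasDerivAt (fun t : ℝ => x + t • (z - x)) ((1 : ℝ) • (z - x)) 0 :=
        ((hasDerivAt_id (0 : ℝ)).smul_const (z - x)).const_add x
      have h2 : HasFDerivAt F (fderiv ℝ F x) (x + (0 : ℝ) • (z - x)) := by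
        simpa using hx.hasFDerivAt
      have := h2.comp_hasDerivAt (0 : ℝ) h1
      rw [one_smul, ← inner_gradient_left] at this
      exact this
    have hc : ConvexOn ℝ univ (fun t : ℝ => F (x + t • (z - x))) := by
      refine ⟨convex_univ, fun s _ t _ a b ha hb hab => ?_⟩
      have := hF.2 (mem_univ (x + s • (z - x))) (mem_univ (x + t • (z - x))) ha hb hab
      convert this using 2
      rw [smul_add, smul_add, smul_smul, smul_smul, smul_eq_mul, smul_eq_mul, add_smul]
      have : x = a • x + b • x := by rw [← add_smul, hab, one_smul]
      nth_rw 1 [this]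
      abel
    have h := hc.le_slope_of_hasDerivAt (mem_univ 0) (mem_univ 1) one_pos hd
    rw [slope_def_field] at h
    simp only [one_smul, zero_smul, add_zero, sub_zero, div_one, add_sub_cancel] at h
    rw [inner_sub_right] at h
    rw [real_inner_comm, real_inner_comm (∇ F x) x]
    linarith
  exact le_antisymm (ciSup_le key) (le_ciSup ⟨_, forall_mem_range.2 key⟩ x)

/-- Inversion of the Legendre transform to second order: if `F` is convex and of class `C²` at `x`
with invertible Hessian `A`, then the Fenchel transform of `F` has Hessian `A⁻¹` at `∇F(x)`. -/
theorem hess_fenchel_gradient (hF : ConvexOn ℝ univ F) {x : Phase n} (hx : ContDiffAt ℝ 2 F x)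
    (A : Phase n ≃L[ℝ] Phase n) (hA : ∀ v w, hess F x v w = ⟪A v, w⟫_ℝ) (v w : Phase n) :
    hess (fenchel F) (∇ F x) v w = ⟪A.symm v, w⟫_ℝ := by
  have hG : ContDiffAt ℝ 1 (∇ F) x :=
    (InnerProductSpace.toDual ℝ (Phase n)).symm.contDiff.contDiffAt.comp x
      (hx.fderiv_right (m := 1) (by norm_num))
  have hG' : HasFDerivAt (∇ F) (A : Phase n →L[ℝ] Phase n) x := by
    have h1 : HasFDerivAt (fderiv ℝ F) (fderiv ℝ (fderiv ℝ F) x) x :=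
      ((hx.fderiv_right (m := 1) (by norm_num)).differentiableAt (by norm_num)).hasFDerivAt
    have h2 := ((InnerProductSpace.toDual ℝ (Phase n)).symm.toContinuousLinearEquiv
      |>.hasFDerivAt (x := fderiv ℝ F x)).comp x h1
    refine HasFDerivAt.congr_fderiv (f := ∇ F) h2 ?_
    ext1 u
    refine ext_inner_right ℝ fun w => ?_
    rw [ContinuousLinearEquiv.coe_coe, ← hA]
    exact InnerProductSpace.toDual_symm_apply (𝕜 := ℝ)
  have hs : HasStrictFDerivAt (∇ F) (A : Phase n →L[ℝ] Phase n) x :=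
    hG.hasStrictFDerivAt' hG' (by norm_num)
  set g := hs.localInverse (∇ F) A x with hg
  have hgc : ContDiffAt ℝ 1 g (∇ F x) := hG.to_localInverse hG' (by norm_num)
  have hgx : g (∇ F x) = x := hs.localInverse_apply_image
  have hinv : ∀ᶠ p in 𝓝 (∇ F x), ∇ F (g p) = p := hs.eventually_right_inverse
  have hdiff : ∀ᶠ p in 𝓝 (∇ F x), DifferentiableAt ℝ g p :=
    (hgc.eventually (by simp)).mono fun p hp => hp.differentiableAt (by norm_num)
  have hFd : ∀ᶠ p in 𝓝 (∇ F x), DifferentiableAt ℝ F (g p) := by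
    refine hgc.continuousAt.eventually ?_
    rw [hgx]
    exact (hx.eventually (by simp)).mono fun p hp => hp.differentiableAt (by norm_num)
  have hval : ∀ᶠ p in 𝓝 (∇ F x), fenchel F p = ⟪g p, p⟫_ℝ - F (g p) := by
    filter_upwards [hinv, hFd] with p h1 h2
    conv_lhs => rw [← h1]
    rw [fenchel_gradient hF h2, h1]
  have hder : fderiv ℝ (fenchel F) =ᶠ[𝓝 (∇ F x)] fun p => innerSL ℝ (g p) := by
    filter_upwards [hval.eventually_nhds, hinv, hdiff, hFd] with p h1 h2 h3 h4
    have h5 := (h3.hasFDerivAt.inner ℝ (hasFDerivAt_id p)).sub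
      (h4.hasFDerivAt.comp p h3.hasFDerivAt)
    have h6 := h5.congr_of_eventuallyEq (f₁ := fenchel F) h1
    rw [h6.fderiv]
    ext u
    have h7 : fderiv ℝ F (g p) (fderiv ℝ g p u) = ⟪p, fderiv ℝ g p u⟫_ℝ := by
      rw [← inner_gradient_left, h2]
    simp [h7, real_inner_comm p]
  have hg' : HasFDerivAt g (A.symm : Phase n →L[ℝ] Phase n) (∇ F x) :=
    hs.to_localInverse.hasFDerivAt
  have h8 := ((innerSL ℝ (E := Phase n)).hasFDerivAt.comp _ hg').congr_of_eventuallyEq hder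
  rw [hess, h8.fderiv]
  rfl

end Fenchel

/-! ### The Hessian of the Hamiltonian and the linearised flow -/

section Hamiltonian

variable {U : Set (Phase n)} {r R : ℝ}

theorem IsPinched.contDiffAt_ham (hU : IsPinched U r R) {x N : Phase n} (hx : x ∈ frontier U)
    (hN : IsOutwardNormal U x N) {c : ℝ} (hc : 0 < c) (α : ℝ) :
    ContDiffAt ℝ 3 (ham U α) (c • x) := by
  have h1 : ContDiffAt ℝ 3 (gauge U) (c⁻¹ • c • x) := by
    rw [inv_smul_smul₀ hc.ne']; exact hU.contDiffAt_gauge hx hN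
  have h2 : ContDiffAt ℝ 3 (fun z : Phase n => gauge U (c⁻¹ • z)) (c • x) :=
    h1.comp (c • x) (contDiff_const_smul c⁻¹).contDiffAt
  have h3 : gauge U = fun z => c * gauge U (c⁻¹ • z) := by
    funext z
    rw [gauge_smul_of_nonneg (inv_nonneg.2 hc.le), smul_eq_mul, mul_inv_cancel_left₀ hc.ne']
  refine ContDiffAt.rpow_const_of_ne ?_ ?_
  · rw [h3]; exact contDiffAt_const.mul h2
  · rw [gauge_smul_of_nonneg hc.le, hU.gauge_eq_one hx]; simpa using hc.ne'

theorem IsPinched.contDiffAt_ham' (hU : IsPinched U r R) {x N : Phase n} (hx : x ∈ frontier U)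
    (hN : IsOutwardNormal U x N) (α : ℝ) : ContDiffAt ℝ 3 (ham U α) x := by
  simpa using hU.contDiffAt_ham hx hN one_pos α

theorem fderiv_ham_smul {c : ℝ} (hc : 0 < c) (α : ℝ) (x : Phase n) :
    fderiv ℝ (ham U α) (c • x) = c ^ (α - 1) • fderiv ℝ (ham U α) x := by
  have h := fderiv_comp_smul (𝕜 := ℝ) (f := ham U α) (x := x) c
  have h1 : (fun z => ham U α (c • z)) = c ^ α • ham U α :=
    funext fun z => ham_smul hc.le α z
  rw [h1, fderiv_const_smul_field, Pi.smul_apply] at h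
  rw [Real.rpow_sub_one hc.ne', div_eq_inv_mul, mul_smul, h, inv_smul_smul₀ hc.ne']

theorem hess_ham_smul {c : ℝ} (hc : 0 < c) (α : ℝ) (x v w : Phase n) :
    hess (ham U α) (c • x) v w = c ^ (α - 2) * hess (ham U α) x v w := by
  have h := fderiv_comp_smul (𝕜 := ℝ) (f := fderiv ℝ (ham U α)) (x := x) c
  have h1 : (fun z => fderiv ℝ (ham U α) (c • z)) =
      c ^ (α - 1) • fderiv ℝ (ham U α) := funext fun z => fderiv_ham_smul hc α z
  rw [h1] at h
  have h2 := congrFun (fderiv_const_smul_field (𝕜 := ℝ) (f := fderiv ℝ (ham U α)) (c ^ (α - 1))) x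
  have h3 := congrArg (fun L => L v w) (h2.symm.trans h)
  simp only [Pi.smul_apply, smul_apply, smul_eq_mul] at h3
  unfold hess
  rw [show α - 2 = α - 1 - 1 by ring, Real.rpow_sub_one hc.ne', div_eq_inv_mul, mul_assoc, h3,
    inv_mul_cancel_left₀ hc.ne']

theorem IsPinched.hasFDerivAt_ham (hU : IsPinched U r R) {x N : Phase n} (hx : x ∈ frontier U)
    (hN : IsOutwardNormal U x N) (α : ℝ) : HasFDerivAt (ham U α) (α • innerSL ℝ N) x := by
  have h := (hasGradientAt_iff_hasFDerivAt.1 (hU.hasGradientAt_gauge hx hN)).rpow_const (p := α)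
    (Or.inl (by rw [hU.gauge_eq_one hx]; exact one_ne_zero))
  rw [hU.gauge_eq_one hx, Real.one_rpow, mul_one] at h
  exact h

theorem IsPinched.gradient_ham_smul (hU : IsPinched U r R) {x N : Phase n} (hx : x ∈ frontier U)
    (hN : IsOutwardNormal U x N) {c : ℝ} (hc : 0 < c) (α : ℝ) :
    ∇ (ham U α) (c • x) = (α * c ^ (α - 1)) • N := by
  refine ext_inner_right ℝ fun v => ?_
  rw [inner_gradient_left, fderiv_ham_smul hc, (hU.hasFDerivAt_ham hx hN α).fderiv]
  simp [inner_smul_left]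
  ring

/-- The Hessians of the powers of the gauge in terms of the Hessian of the gauge. -/
theorem IsPinched.hess_ham (hU : IsPinched U r R) {x N : Phase n} (hx : x ∈ frontier U)
    (hN : IsOutwardNormal U x N) (α : ℝ) (v w : Phase n) :
    hess (ham U α) x v w =
      α * (hess (gauge U) x v w + (α - 1) * (⟪N, v⟫_ℝ * ⟪N, w⟫_ℝ)) := by
  have hj := hU.contDiffAt_gauge hx hN
  have hev : fderiv ℝ (ham U α) =ᶠ[𝓝 x]
      fun z => (α * gauge U z ^ (α - 1)) • fderiv ℝ (gauge U) z := by
    filter_upwards [hj.eventually (by simp),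
      hj.continuousAt.eventually_ne (y := 0) (by rw [hU.gauge_eq_one hx]; exact one_ne_zero)]
      with z h1 h2
    exact ((h1.differentiableAt (by norm_num)).hasFDerivAt.rpow_const (Or.inl h2)).fderiv
  have hg := hasGradientAt_iff_hasFDerivAt.1 (hU.hasGradientAt_gauge hx hN)
  have h1 := (hg.rpow_const (p := α - 1)
    (Or.inl (by rw [hU.gauge_eq_one hx]; exact one_ne_zero))).const_mul α
  have h2 : HasFDerivAt (fderiv ℝ (gauge U)) (fderiv ℝ (fderiv ℝ (gauge U)) x) x :=
    ((hj.fderiv_right (m := 2) (by norm_num)).differentiableAt (by norm_num)).hasFDerivAt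
  have h3 := (h1.smul h2).congr_of_eventuallyEq hev
  unfold hess
  rw [h3.fderiv, hg.fderiv, hU.gauge_eq_one hx]
  simp
  ring

theorem IsPinched.hess_ham_eq (hU : IsPinched U r R) {x N : Phase n} (hx : x ∈ frontier U)
    (hN : IsOutwardNormal U x N) (α : ℝ) (v w : Phase n) :
    hess (ham U α) x v w =
      α * (1 / 2 * hess (ham U 2) x v w - (2 - α) * (⟪N, v⟫_ℝ * ⟪N, w⟫_ℝ)) := by
  rw [hU.hess_ham hx hN, hU.hess_ham hx hN]
  ring

/-- The operator `½ H₂''(x)` on the phase space, as the derivative of the vector field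
`½ ∇H₂`. -/
noncomputable def hessMap (U : Set (Phase n)) (x : Phase n) : Phase n →L[ℝ] Phase n :=
  fderiv ℝ (fun z => (1 / 2 : ℝ) • ∇ (ham U 2) z) x

theorem IsPinched.contDiffAt_gradient (hU : IsPinched U r R) {x N : Phase n}
    (hx : x ∈ frontier U) (hN : IsOutwardNormal U x N) :
    ContDiffAt ℝ 2 (fun z => (1 / 2 : ℝ) • ∇ (ham U 2) z) x := by
  have h : ContDiffAt ℝ 2 (∇ (ham U 2)) x :=
    (InnerProductSpace.toDual ℝ (Phase n)).symm.contDiff.contDiffAt.comp x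
      ((hU.contDiffAt_ham' hx hN 2).fderiv_right (m := 2) (by norm_num))
  exact h.const_smul (1 / 2 : ℝ)

theorem IsPinched.hasFDerivAt_gradient (hU : IsPinched U r R) {x N : Phase n}
    (hx : x ∈ frontier U) (hN : IsOutwardNormal U x N) :
    HasFDerivAt (fun z => (1 / 2 : ℝ) • ∇ (ham U 2) z) (hessMap U x) x :=
  ((hU.contDiffAt_gradient hx hN).differentiableAt (by norm_num)).hasFDerivAt

theorem IsPinched.continuousAt_hessMap (hU : IsPinched U r R) {x N : Phase n}
    (hx : x ∈ frontier U) (hN : IsOutwardNormal U x N) : ContinuousAt (hessMap U) x :=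
  ((hU.contDiffAt_gradient hx hN).fderiv_right (m := 1) (by norm_num)).continuousAt

theorem IsPinched.inner_hessMap (hU : IsPinched U r R) {x N : Phase n} (hx : x ∈ frontier U)
    (hN : IsOutwardNormal U x N) (v w : Phase n) :
    ⟪hessMap U x v, w⟫_ℝ = 1 / 2 * hess (ham U 2) x v w := by
  have h1 : HasFDerivAt (fderiv ℝ (ham U 2)) (fderiv ℝ (fderiv ℝ (ham U 2)) x) x :=
    (((hU.contDiffAt_ham' hx hN 2).fderiv_right (m := 2) (by norm_num)).differentiableAt
      (by norm_num)).hasFDerivAt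
  have h2 := (h1.clm_apply (hasFDerivAt_const w x)).const_mul (1 / 2 : ℝ)
  have h3 := (hU.hasFDerivAt_gradient hx hN).inner ℝ (hasFDerivAt_const w x)
  have h4 : (fun z => ⟪(1 / 2 : ℝ) • ∇ (ham U 2) z, w⟫_ℝ) =
      fun z => 1 / 2 * fderiv ℝ (ham U 2) z w := by
    funext z
    rw [real_inner_smul_left, inner_gradient_left]
  rw [h4] at h3
  have h5 := congrArg (fun L => L v) (h3.unique h2)
  simpa [hess] using h5

theorem IsPinched.hess_ham_comm (hU : IsPinched U r R) {x N : Phase n} (hx : x ∈ frontier U)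
    (hN : IsOutwardNormal U x N) (α : ℝ) (v w : Phase n) :
    hess (ham U α) x v w = hess (ham U α) x w v :=
  ((hU.contDiffAt_ham' hx hN α).isSymmSndFDerivAt (by
    rw [minSmoothness_of_isRCLikeNormedField]; norm_num)).eq v w

/-- Euler's relation for the gradient of `½ H₂`, which is homogeneous of degree one. -/
theorem IsPinched.hessMap_self (hU : IsPinched U r R) {x N : Phase n} (hx : x ∈ frontier U)
    (hN : IsOutwardNormal U x N) : hessMap U x x = N := by
  refine ext_inner_right ℝ fun w => ?_
  have h1 : HasFDerivAt (fderiv ℝ (ham U 2)) (fderiv ℝ (fderiv ℝ (ham U 2)) x) ((1 : ℝ) • x) := by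
    rw [one_smul]
    exact (((hU.contDiffAt_ham' hx hN 2).fderiv_right (m := 2) (by norm_num)).differentiableAt
      (by norm_num)).hasFDerivAt
  have h2 := h1.comp_hasDerivAt (1 : ℝ) ((hasDerivAt_id (1 : ℝ)).smul_const x)
  have h3 : HasDerivAt (fun s : ℝ => s • fderiv ℝ (ham U 2) x)
      ((1 : ℝ) • fderiv ℝ (ham U 2) x) 1 :=
    (hasDerivAt_id (1 : ℝ)).smul_const (fderiv ℝ (ham U 2) x)
  have h4 := h3.congr_of_eventuallyEq
    (f₁ := fun s : ℝ => fderiv ℝ (ham U 2) (s • x)) (by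
      filter_upwards [lt_mem_nhds one_pos] with s hs
      rw [fderiv_ham_smul hs]
      norm_num)
  have h5 := h2.unique h4
  rw [hU.inner_hessMap hx hN]
  unfold hess
  have h6 : fderiv ℝ (fderiv ℝ (ham U 2)) x x = fderiv ℝ (ham U 2) x := by simpa using h5
  rw [h6, (hU.hasFDerivAt_ham hx hN 2).fderiv]
  simp

end Hamiltonian

section Frame

@[simp] theorem J_inl (v : Phase n) (m : Fin n) : J n v (Sum.inl m) = -v (Sum.inr m) := by
  change (Matrix.J (Fin n) ℝ).mulVec v.ofLp (Sum.inl m) = _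
  simp [Matrix.J, Matrix.mulVec, dotProduct, Fintype.sum_sum_type, Matrix.one_apply]

@[simp] theorem J_inr (v : Phase n) (m : Fin n) : J n v (Sum.inr m) = v (Sum.inl m) := by
  change (Matrix.J (Fin n) ℝ).mulVec v.ofLp (Sum.inr m) = _
  simp [Matrix.J, Matrix.mulVec, dotProduct, Fintype.sum_sum_type, Matrix.one_apply]

theorem inner_J_left (v w : Phase n) : ⟪J n v, w⟫_ℝ = -⟪v, J n w⟫_ℝ := by
  simp only [PiLp.inner_apply, Fintype.sum_sum_type, J_inl, J_inr, RCLike.inner_apply,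
    RCLike.conj_to_real, neg_add, ← Finset.sum_neg_distrib]
  rw [← Finset.sum_add_distrib, ← Finset.sum_add_distrib]
  exact Finset.sum_congr rfl fun m _ => by ring

theorem J_J (v : Phase n) : J n (J n v) = -v := by
  ext (m | m) <;> simp

theorem inner_J_J (v w : Phase n) : ⟪J n v, J n w⟫_ℝ = ⟪v, w⟫_ℝ := by
  rw [inner_J_left, J_J, inner_neg_right, neg_neg]

theorem inner_J_self (v : Phase n) : ⟪J n v, v⟫_ℝ = 0 := by
  have := inner_J_left v v
  rw [real_inner_comm (J n v) v] at this
  linarith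

/-- The linearisation of the characteristic flow along a closed orbit `w` of period one with
normal `N`: the operators `S t` stand for `½ H₂''(w t)`, whence Euler's relation `S w = N`. -/
structure IsFrame (τ r R : ℝ) (w N : ℝ → Phase n) (S : ℝ → Phase n →L[ℝ] Phase n) : Prop where
  τ_pos : 0 < τ
  r_pos : 0 < r
  R_pos : 0 < R
  hasDerivAt : ∀ t, HasDerivAt w (τ • J n (N t)) t
  hasDerivAt_normal : ∀ t, HasDerivAt N (S t (τ • J n (N t))) t
  continuous : Continuous S
  symm : ∀ t u v, ⟪S t u, v⟫_ℝ = ⟪u, S t v⟫_ℝ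
  apply_self : ∀ t, S t (w t) = N t
  inner_eq_one : ∀ t, ⟪N t, w t⟫_ℝ = 1
  lower : ∀ t v, ‖v‖ ^ 2 / R ^ 2 ≤ ⟪S t v, v⟫_ℝ
  upper : ∀ t v, ⟪S t v, v⟫_ℝ ≤ ‖v‖ ^ 2 / r ^ 2
  closed : w 1 = w 0

/-- A closed characteristic, run through in time one, carries a frame. -/
theorem IsClosedChar.exists_isFrame {U : Set (Phase n)} {r R τ : ℝ} {y : ℝ → Phase n}
    (hU : IsPinched U r R) (hy : IsClosedChar U τ y) :
    ∃ N : ℝ → Phase n, (∀ t, IsOutwardNormal U (y (τ * t)) (N t)) ∧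
      IsFrame τ r R (fun t => y (τ * t)) N (fun t => hessMap U (y (τ * t))) := by
  choose N hN hd using hy.eqn
  have hlin : ∀ t, HasDerivAt (fun t : ℝ => τ * t) τ t := fun t => by
    simpa using (hasDerivAt_id t).const_mul τ
  have hw : ∀ t, HasDerivAt (fun t => y (τ * t)) (τ • J n (N (τ * t))) t := fun t =>
    (hd (τ * t)).scomp t (hlin t)
  have hNeq : ∀ t, (1 / 2 : ℝ) • ∇ (ham U 2) (y t) = N t := fun t => by
    have := hU.gradient_ham_smul (hy.mem t) (hN t) one_pos 2
    rw [one_smul] at this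
    rw [this, smul_smul]
    norm_num
  refine ⟨fun t => N (τ * t), fun t => hN _, hy.pos, hU.r_pos, hU.r_pos.trans_le hU.r_le, hw,
    fun t => ?_, ?_, fun t u v => ?_, fun t => hU.hessMap_self (hy.mem _) (hN _), fun t => (hN _).2,
    fun t v => ?_, fun t v => ?_, ?_⟩
  · have h := (hU.hasFDerivAt_gradient (hy.mem (τ * t)) (hN _)).comp_hasDerivAt t (hw t)
    simpa only [Function.comp_def, hNeq] using h
  · refine continuous_iff_continuousAt.2 fun t => ?_
    exact ContinuousAt.comp (f := fun t => y (τ * t))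
      (hU.continuousAt_hessMap (hy.mem (τ * t)) (hN _)) (hw t).continuousAt
  · rw [real_inner_comm _ u, hU.inner_hessMap (hy.mem _) (hN _),
      hU.inner_hessMap (hy.mem _) (hN _), hU.hess_ham_comm (hy.mem _) (hN _)]
  · rw [hU.inner_hessMap (hy.mem _) (hN _)]; exact hU.lower _ (hy.mem _) v
  · rw [hU.inner_hessMap (hy.mem _) (hN _)]; exact hU.upper _ (hy.mem _) v
  · simp [hy.closed]

namespace IsFrame

variable {τ r R : ℝ} {w N : ℝ → Phase n} {S : ℝ → Phase n →L[ℝ] Phase n}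

theorem isUnit (h : IsFrame τ r R w N S) (t : ℝ) : IsUnit (S t) := by
  have hR := h.R_pos
  have hinj : Function.Injective (S t) := by
    refine (injective_iff_map_eq_zero (S t)).2 fun v hv => ?_
    have := h.lower t v
    rw [hv, inner_zero_left, div_le_iff₀ (by positivity), zero_mul] at this
    simpa using this
  let e := (LinearEquiv.ofInjectiveEndo (S t : Phase n →ₗ[ℝ] Phase n) hinj).toContinuousLinearEquiv
  refine ⟨ContinuousLinearEquiv.toUnit e, ?_⟩
  ext1 v
  rfl

theorem apply_inverse (h : IsFrame τ r R w N S) (t : ℝ) (v : Phase n) :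
    S t (Ring.inverse (S t) v) = v :=
  DFunLike.congr_fun (Ring.mul_inverse_cancel _ (h.isUnit t)) v

theorem inverse_apply (h : IsFrame τ r R w N S) (t : ℝ) (v : Phase n) :
    Ring.inverse (S t) (S t v) = v :=
  DFunLike.congr_fun (Ring.inverse_mul_cancel _ (h.isUnit t)) v

theorem inverse_normal (h : IsFrame τ r R w N S) (t : ℝ) : Ring.inverse (S t) (N t) = w t := by
  rw [← h.apply_self, h.inverse_apply]

theorem inverse_symm (h : IsFrame τ r R w N S) (t : ℝ) (u v : Phase n) :
    ⟪Ring.inverse (S t) u, v⟫_ℝ = ⟪u, Ring.inverse (S t) v⟫_ℝ := by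
  conv_lhs => rw [← h.apply_inverse t v]
  rw [← h.symm, h.apply_inverse]

theorem continuous_inverse (h : IsFrame τ r R w N S) :
    Continuous fun t => Ring.inverse (S t) := by
  refine continuous_iff_continuousAt.2 fun t => ?_
  obtain ⟨u, hu⟩ := h.isUnit t
  have := NormedRing.inverse_continuousAt u
  rw [hu] at this
  exact ContinuousAt.comp this h.continuous.continuousAt

theorem inverse_le (h : IsFrame τ r R w N S) (t : ℝ) (v : Phase n) :
    ⟪Ring.inverse (S t) v, v⟫_ℝ ≤ R ^ 2 * ‖v‖ ^ 2 := by
  have hR := h.R_pos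
  set u := Ring.inverse (S t) v with hu
  have h1 := h.lower t u
  rw [hu, h.apply_inverse, ← hu, div_le_iff₀ (by positivity), real_inner_comm] at h1
  have h2 : ⟪u, v⟫_ℝ ≤ ‖u‖ * ‖v‖ := real_inner_le_norm u v
  have h3 : ‖u‖ ≤ R ^ 2 * ‖v‖ := by
    by_contra hcon
    push Not at hcon
    have : 0 < ‖u‖ := lt_of_le_of_lt (by positivity) hcon
    nlinarith [sq_nonneg R]
  calc ⟪u, v⟫_ℝ ≤ ‖u‖ * ‖v‖ := h2
    _ ≤ R ^ 2 * ‖v‖ * ‖v‖ := by gcongr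
    _ = _ := by ring

theorem le_inverse (h : IsFrame τ r R w N S) (t : ℝ) (v : Phase n) :
    r ^ 2 * ‖v‖ ^ 2 ≤ ⟪Ring.inverse (S t) v, v⟫_ℝ := by
  have hr := h.r_pos
  have hR := h.R_pos
  set u := Ring.inverse (S t) v with hu
  have hSu : S t u = v := h.apply_inverse t v
  -- nonnegativity of `S` at `u - r² v` is the Cauchy–Schwarz inequality for `S`
  have h1 : 0 ≤ ⟪S t (u - r ^ 2 • v), u - r ^ 2 • v⟫_ℝ :=
    le_trans (by positivity) (h.lower t _)
  have h2 : ⟪S t v, u⟫_ℝ = ‖v‖ ^ 2 := by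
    rw [h.symm, hSu, real_inner_self_eq_norm_sq]
  have h3 := h.upper t v
  rw [le_div_iff₀ (by positivity)] at h3
  simp only [map_sub, map_smul, hSu, inner_sub_left, inner_sub_right, inner_smul_left,
    inner_smul_right, h2, real_inner_self_eq_norm_sq, real_inner_comm u v, RCLike.conj_to_real] at h1
  have h4 : r ^ 2 * ‖v‖ ^ 2 ≤ ⟪u, v⟫_ℝ := by nlinarith [mul_le_mul_of_nonneg_left h3 (sq_nonneg r)]
  exact h4

end IsFrame

end Frame

/-! ### The solution associated with a closed characteristic -/

section AssociatedSolution

variable {τ r R : ℝ} {w N : ℝ → Phase n} {S : ℝ → Phase n →L[ℝ] Phase n}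

/-- The Hessian `τ (S - (2 - α) N ⊗ N)` of `H_α` along the rescaled orbit as an invertible operator;
its inverse `τ⁻¹ (S⁻¹ + (2 - α) / (α - 1) w ⊗ w)` is given by the Sherman–Morrison formula. -/
noncomputable def IsFrame.hamEquiv (h : IsFrame τ r R w N S) {α : ℝ} (hα : 1 < α) (t : ℝ) :
    Phase n ≃L[ℝ] Phase n :=
  ContinuousLinearEquiv.equivOfInverse
    (τ • (S t - (2 - α) • (innerSL ℝ (N t)).smulRight (N t)))
    (τ⁻¹ • (Ring.inverse (S t) + ((2 - α) / (α - 1)) • (innerSL ℝ (w t)).smulRight (w t)))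
    (fun v => by
      have h1 : α - 1 ≠ 0 := by linarith
      have hτ := h.τ_pos.ne'
      have h2 : ⟪w t, S t v⟫_ℝ = ⟪N t, v⟫_ℝ := by rw [← h.symm, h.apply_self]
      have h3 : ⟪w t, N t⟫_ℝ = 1 := by rw [real_inner_comm, h.inner_eq_one]
      simp only [smul_apply, add_apply, sub_apply, ContinuousLinearMap.smulRight_apply,
        innerSL_apply_apply, map_smul, map_sub, h.inverse_apply, h.inverse_normal, h2, h3]
      match_scalars
      all_goals field_simp
      ring)
    (fun v => by
      have h1 : α - 1 ≠ 0 := by linarith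
      have hτ := h.τ_pos.ne'
      have h2 : ⟪N t, Ring.inverse (S t) v⟫_ℝ = ⟪w t, v⟫_ℝ := by
        rw [← h.inverse_symm, h.inverse_normal]
      simp only [smul_apply, add_apply, sub_apply, ContinuousLinearMap.smulRight_apply,
        innerSL_apply_apply, map_smul, map_add, h.apply_inverse, h.apply_self, h2,
        h.inner_eq_one]
      match_scalars
      all_goals field_simp
      ring)

theorem IsFrame.inner_hamEquiv (h : IsFrame τ r R w N S) {α : ℝ} (hα : 1 < α) (t : ℝ)
    (u v : Phase n) : ⟪h.hamEquiv hα t u, v⟫_ℝ =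
      τ * (⟪S t u, v⟫_ℝ - (2 - α) * (⟪N t, u⟫_ℝ * ⟪N t, v⟫_ℝ)) := by
  change ⟪τ • (S t u - (2 - α) • ⟪N t, u⟫_ℝ • N t), v⟫_ℝ = _
  rw [real_inner_smul_left, inner_sub_left, real_inner_smul_left, real_inner_smul_left]

theorem IsFrame.inner_hamEquiv_symm (h : IsFrame τ r R w N S) {α : ℝ} (hα : 1 < α) (t : ℝ)
    (u v : Phase n) : ⟪(h.hamEquiv hα t).symm u, v⟫_ℝ =
      τ⁻¹ * (⟪Ring.inverse (S t) u, v⟫_ℝ +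
        (2 - α) / (α - 1) * (⟪w t, u⟫_ℝ * ⟪w t, v⟫_ℝ)) := by
  change ⟪τ⁻¹ • (Ring.inverse (S t) u + ((2 - α) / (α - 1)) • ⟪w t, u⟫_ℝ • w t), v⟫_ℝ = _
  rw [real_inner_smul_left, inner_add_left, real_inner_smul_left, real_inner_smul_left]

variable {U : Set (Phase n)} {y : ℝ → Phase n} {α : ℝ}

/-- The dilation factor of an associated solution is determined by the period. -/
theorem mul_eq_iff_eq_rpow {c : ℝ} (hτ : 0 < τ) (hc : 0 < c) (hα : α ∈ Ioo (1 : ℝ) 2) :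
    c * τ = α * c ^ (α - 1) ↔ c = (α / τ) ^ (2 - α)⁻¹ := by
  have h1 : 0 < c ^ (α - 1) := Real.rpow_pos_of_pos hc _
  have h2 : c = c ^ (2 - α) * c ^ (α - 1) := by
    rw [← Real.rpow_add hc]
    norm_num
  have h3 : 2 - α ≠ 0 := by linarith [hα.2]
  have h4 : 0 ≤ α / τ := div_nonneg (by linarith [hα.1]) hτ.le
  have h5 : c * τ = c ^ (2 - α) * τ * c ^ (α - 1) := by
    nth_rw 1 [h2]
    ring
  rw [Real.eq_rpow_inv hc.le h4 h3, eq_div_iff hτ.ne', h5, mul_left_inj' h1.ne']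

theorem hasDerivAt_dilate (h : IsFrame τ r R w N S) (c t : ℝ) :
    HasDerivAt (fun t => c • w t) ((c * τ) • J n (N t)) t := by
  rw [mul_smul]
  exact (h.hasDerivAt t).const_smul c

theorem J_injective : Function.Injective (J n) := fun u v h => by
  have := congrArg (J n) h
  rwa [J_J, J_J, neg_inj] at this

theorem IsFrame.normal_ne_zero (h : IsFrame τ r R w N S) (t : ℝ) : N t ≠ 0 := fun h0 => by
  have := h.inner_eq_one t
  rw [h0, inner_zero_left] at this
  exact zero_ne_one this

theorem isAssociatedSol_iff (hU : IsPinched U r R) (hy : IsClosedChar U τ y)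
    (hN : ∀ t, IsOutwardNormal U (y (τ * t)) (N t))
    (h : IsFrame τ r R (fun t => y (τ * t)) N S) (hα : α ∈ Ioo (1 : ℝ) 2) (x : ℝ → Phase n) :
    IsAssociatedSol U α τ y x ↔ x = fun t => ((α / τ) ^ (2 - α)⁻¹) • y (τ * t) := by
  have hp : 0 < (α / τ) ^ (2 - α)⁻¹ :=
    Real.rpow_pos_of_pos (div_pos (by linarith [hα.1]) hy.pos) _
  constructor
  · intro hx
    obtain ⟨c, hc, hxc⟩ := hx.dilate
    obtain rfl : x = fun t => c • y (τ * t) := funext hxc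
    have h1 := (hx.eqn 0).unique (hasDerivAt_dilate h c 0)
    rw [hU.gradient_ham_smul (hy.mem _) (hN 0) hc, map_smul] at h1
    have h2 : J n (N 0) ≠ 0 := fun h0 =>
      h.normal_ne_zero 0 (J_injective (by rw [h0, map_zero]))
    have h3 := smul_left_injective ℝ h2 h1
    rw [← (mul_eq_iff_eq_rpow hy.pos hc hα).1 h3.symm]
  · rintro rfl
    refine ⟨fun t => ?_, ?_, ⟨_, hp, fun t => rfl⟩⟩
    · have h1 := (mul_eq_iff_eq_rpow hy.pos hp hα).2 rfl
      rw [hU.gradient_ham_smul (hy.mem _) (hN t) hp, ← h1, map_smul]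
      exact hasDerivAt_dilate h _ t
    · simp [hy.closed]

/-- The Hessian of the dual Hamiltonian along the associated solution. -/
theorem hess_fenchel_ham (hU : IsPinched U r R) (hy : IsClosedChar U τ y)
    (hN : ∀ t, IsOutwardNormal U (y (τ * t)) (N t))
    (h : IsFrame τ r R (fun t => y (τ * t)) N (fun t => hessMap U (y (τ * t))))
    (hα : α ∈ Ioo (1 : ℝ) 2) {x : ℝ → Phase n} (hx : IsAssociatedSol U α τ y x) (t : ℝ)
    (u v : Phase n) :
    hess (fenchel (ham U α)) (-(J n (deriv x t))) u v =
      τ⁻¹ * (⟪Ring.inverse (hessMap U (y (τ * t))) u, v⟫_ℝ +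
        (2 - α) / (α - 1) * (⟪y (τ * t), u⟫_ℝ * ⟪y (τ * t), v⟫_ℝ)) := by
  have hp : 0 < (α / τ) ^ (2 - α)⁻¹ :=
    Real.rpow_pos_of_pos (div_pos (by linarith [hα.1]) hy.pos) _
  obtain rfl := (isAssociatedSol_iff hU hy hN h hα x).1 hx
  have h1 := (mul_eq_iff_eq_rpow hy.pos hp hα).2 rfl
  set c := (α / τ) ^ (2 - α)⁻¹
  have h2 : -(J n (deriv (fun t => c • y (τ * t)) t)) = ∇ (ham U α) (c • y (τ * t)) := by
    rw [(hasDerivAt_dilate h c t).deriv, map_smul, J_J, smul_neg, neg_neg,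
      hU.gradient_ham_smul (hy.mem _) (hN t) hp, h1]
  rw [h2, hess_fenchel_gradient (hU.convexOn_ham hα.1.le)
    ((hU.contDiffAt_ham (hy.mem _) (hN t) hp α).of_le (by norm_num)) (h.hamEquiv hα.1 t),
    h.inner_hamEquiv_symm]
  intro a b
  rw [hess_ham_smul hp, hU.hess_ham_eq (hy.mem _) (hN t), h.inner_hamEquiv,
    hU.inner_hessMap (hy.mem _) (hN t), ← mul_assoc]
  congr 1
  rw [show α - 2 = α - 1 - 1 by ring, Real.rpow_sub_one hp.ne', div_mul_eq_mul_div,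
    div_eq_iff hp.ne', mul_comm _ α, ← h1, mul_comm]

end AssociatedSolution

/-! ### Fourier coefficients on the unit interval -/

section Fourier

open Complex ComplexConjugate

/-- The `j`-th Fourier coefficient of a complex function on the unit interval. -/
noncomputable def fcoeff (f : ℝ → ℂ) (j : ℤ) : ℂ := fourierCoeffOn zero_lt_one f j

theorem fcoeff_eq (f : ℝ → ℂ) (j : ℤ) :
    fcoeff f j = ∫ t in (0 : ℝ)..1, exp (-(2 * Real.pi * j * t * I)) * f t := by
  rw [fcoeff, fourierCoeffOn_eq_integral]
  simp only [sub_zero, div_one, one_smul, smul_eq_mul]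
  refine intervalIntegral.integral_congr fun t _ => ?_
  rw [fourier_coe_apply]
  congr 2
  push_cast
  ring

theorem intervalIntegrable_exp_mul {f : ℝ → ℂ} (hf : IntervalIntegrable f volume 0 1) (j : ℤ) :
    IntervalIntegrable (fun t : ℝ => exp (-(2 * Real.pi * j * t * I)) * f t) volume 0 1 :=
  hf.continuousOn_mul (by fun_prop)

theorem fcoeff_add {f g : ℝ → ℂ} (hf : IntervalIntegrable f volume 0 1)
    (hg : IntervalIntegrable g volume 0 1) (j : ℤ) :
    fcoeff (fun t => f t + g t) j = fcoeff f j + fcoeff g j := by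
  simp only [fcoeff_eq, mul_add]
  exact intervalIntegral.integral_add (intervalIntegrable_exp_mul hf j)
    (intervalIntegrable_exp_mul hg j)

theorem fcoeff_const_mul (c : ℂ) (f : ℝ → ℂ) (j : ℤ) :
    fcoeff (fun t => c * f t) j = c * fcoeff f j := by
  simp only [fcoeff_eq, mul_left_comm _ c]
  exact intervalIntegral.integral_const_mul _ _

theorem fcoeff_congr {f g : ℝ → ℂ} (h : f =ᵐ[volume.restrict (Ioc 0 1)] g) (j : ℤ) :
    fcoeff f j = fcoeff g j :=
  congrFun (fourierCoeffOn_congr_ae zero_lt_one h) j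

theorem intervalIntegrable_of_memLp {E : Type*} [NormedAddCommGroup E] {f : ℝ → E}
    (hf : MemLp f 2 (volume.restrict (Ioc (0 : ℝ) 1))) : IntervalIntegrable f volume 0 1 := by
  rw [intervalIntegrable_iff_integrableOn_Ioc_of_le zero_le_one]
  exact hf.integrable one_le_two

theorem re_conj_mul_eq (a b : ℂ) :
    (conj a * b).re = (‖a + b‖ ^ 2 - ‖a + (-1) * b‖ ^ 2) / 4 := by
  simp only [← normSq_eq_norm_sq, normSq_apply]
  simp
  ring

/-- Parseval's identity, polarised. -/
theorem hasSum_fcoeff {f g : ℝ → ℂ} (hf : MemLp f 2 (volume.restrict (Ioc (0 : ℝ) 1)))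
    (hg : MemLp g 2 (volume.restrict (Ioc (0 : ℝ) 1))) :
    HasSum (fun j => (conj (fcoeff f j) * fcoeff g j).re)
      (∫ t in (0 : ℝ)..1, (conj (f t) * g t).re) := by
  have hg' : MemLp (fun t => (-1) * g t) 2 (volume.restrict (Ioc (0 : ℝ) 1)) := hg.const_mul (-1)
  have hp : MemLp (fun t => f t + g t) 2 (volume.restrict (Ioc (0 : ℝ) 1)) := hf.add hg
  have hm : MemLp (fun t => f t + (-1) * g t) 2 (volume.restrict (Ioc (0 : ℝ) 1)) := hf.add hg'
  have h1 := hasSum_sq_fourierCoeffOn zero_lt_one hp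
  have h2 := hasSum_sq_fourierCoeffOn zero_lt_one hm
  have h3 := (h1.sub h2).div_const 4
  have hint : ∀ {u : ℝ → ℂ}, MemLp u 2 (volume.restrict (Ioc (0 : ℝ) 1)) →
      IntervalIntegrable (fun t => ‖u t‖ ^ 2) volume 0 1 := fun hu => by
    rw [intervalIntegrable_iff_integrableOn_Ioc_of_le zero_le_one]
    exact hu.integrable_norm_pow two_ne_zero
  have h4 : ∀ j, (conj (fcoeff f j) * fcoeff g j).re =
      (‖fcoeff (fun t => f t + g t) j‖ ^ 2 - ‖fcoeff (fun t => f t + (-1) * g t) j‖ ^ 2) / 4 :=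
    fun j => by
      rw [re_conj_mul_eq, ← fcoeff_const_mul, ← fcoeff_add (intervalIntegrable_of_memLp hf)
        (intervalIntegrable_of_memLp hg), ← fcoeff_add (intervalIntegrable_of_memLp hf)
        (intervalIntegrable_of_memLp hg')]
  simp only [h4, re_conj_mul_eq]
  rw [intervalIntegral.integral_div, intervalIntegral.integral_sub (hint hp) (hint hm)]
  simp only [sub_zero, inv_one, one_smul] at h3
  exact h3

/-- Fubini's theorem on the triangle `s ≤ t`. -/
theorem integral_mul_integral_eq {f h : ℝ → ℂ} (hf : IntervalIntegrable f volume 0 1)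
    (hh : IntervalIntegrable h volume 0 1) :
    ∫ t in (0 : ℝ)..1, h t * ∫ s in (0 : ℝ)..t, f s =
      ∫ s in (0 : ℝ)..1, f s * ∫ t in s..1, h t := by
  rw [intervalIntegrable_iff_integrableOn_Ioc_of_le zero_le_one] at hf hh
  set μ := volume.restrict (Ioc (0 : ℝ) 1)
  have hint : Integrable (Function.uncurry fun t s => ({p : ℝ × ℝ | p.2 ≤ p.1}).indicator
      (fun p => h p.1 * f p.2) (t, s)) (μ.prod μ) :=
    (Integrable.mul_prod hh hf).indicator (measurableSet_le measurable_snd measurable_fst)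
  have hswap := integral_integral_swap hint
  rw [intervalIntegral.integral_of_le zero_le_one, intervalIntegral.integral_of_le zero_le_one]
  convert hswap using 1
  · refine setIntegral_congr_fun measurableSet_Ioc fun t ht => ?_
    have h1 : (fun s => ({p : ℝ × ℝ | p.2 ≤ p.1}).indicator (fun p => h p.1 * f p.2) (t, s)) =
        (Iic t).indicator fun s => h t * f s := by
      funext s
      simp [indicator]
    rw [h1, setIntegral_indicator measurableSet_Iic, Ioc_inter_Iic, min_eq_right ht.2,
      integral_const_mul, intervalIntegral.integral_of_le ht.1.le]
  · refine setIntegral_congr_fun measurableSet_Ioc fun s hs => ?_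
    have h1 : (fun t => ({p : ℝ × ℝ | p.2 ≤ p.1}).indicator (fun p => h p.1 * f p.2) (t, s)) =
        (Ici s).indicator fun t => f s * h t := by
      funext t
      simp [indicator, mul_comm]
    have h2 : Ioc 0 1 ∩ Ici s = Icc s 1 := by
      ext t
      simp only [mem_inter_iff, mem_Ioc, mem_Ici, mem_Icc]
      constructor
      · rintro ⟨⟨_, h⟩, h'⟩; exact ⟨h', h⟩
      · rintro ⟨h, h'⟩; exact ⟨⟨hs.1.trans_le h, h'⟩, h⟩
    rw [h1, setIntegral_indicator measurableSet_Ici, h2, integral_const_mul,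
      integral_Icc_eq_integral_Ioc, intervalIntegral.integral_of_le hs.2]

theorem integral_exp {j : ℤ} (hj : j ≠ 0) (a : ℝ) :
    ∫ t in a..1, exp (-(2 * Real.pi * j * t * I)) =
      (exp (-(2 * Real.pi * j * a * I)) - 1) / (2 * Real.pi * j * I) := by
  have hc : (-(2 * Real.pi * j * I) : ℂ) ≠ 0 := by
    simp [Real.pi_ne_zero, hj]
  have h1 := integral_exp_mul_complex (a := a) (b := 1) hc
  have h2 : exp (-(2 * Real.pi * j * I)) = 1 := by
    have := exp_int_mul_two_pi_mul_I (-j)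
    rw [← this]
    congr 1
    push_cast
    ring
  have h3 : ∀ t : ℝ, -(2 * Real.pi * j * t * I) = -(2 * Real.pi * j * I) * (t : ℂ) := fun t => by
    ring
  simp only [h3]
  rw [h1, ofReal_one, mul_one, h2, div_neg, ← neg_div, neg_sub]

/-- Integration divides the `j`-th Fourier coefficient by `2πij`. -/
theorem fcoeff_primitive {f : ℝ → ℂ} (hf : IntervalIntegrable f volume 0 1)
    (h0 : ∫ t in (0 : ℝ)..1, f t = 0) (c : ℂ) {j : ℤ} (hj : j ≠ 0) :
    fcoeff (fun t => (∫ s in (0 : ℝ)..t, f s) - c) j = fcoeff f j / (2 * Real.pi * j * I) := by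
  have hexp : IntervalIntegrable (fun t : ℝ => exp (-(2 * Real.pi * j * t * I))) volume 0 1 :=
    Continuous.intervalIntegrable (by fun_prop) _ _
  have hcont : ContinuousOn (fun t => ∫ s in (0 : ℝ)..t, f s) (uIcc 0 1) :=
    intervalIntegral.continuousOn_primitive_interval' hf (by simp)
  have h1 : IntervalIntegrable (fun t => exp (-(2 * Real.pi * j * t * I)) *
      ∫ s in (0 : ℝ)..t, f s) volume 0 1 := hexp.mul_continuousOn hcont
  rw [fcoeff_eq, fcoeff_eq]
  simp only [mul_sub]
  rw [intervalIntegral.integral_sub h1 (hexp.mul_const c), integral_mul_integral_eq hf hexp,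
    intervalIntegral.integral_mul_const, integral_exp hj]
  simp only [integral_exp hj]
  have h2 : ∀ t : ℝ, f t * ((exp (-(2 * Real.pi * j * t * I)) - 1) / (2 * Real.pi * j * I)) =
      (exp (-(2 * Real.pi * j * t * I)) * f t - f t) / (2 * Real.pi * j * I) := fun t => by ring
  simp only [h2]
  rw [intervalIntegral.integral_div,
    intervalIntegral.integral_sub (intervalIntegrable_exp_mul hf j) hf, h0]
  simp

theorem fcoeff_zero (f : ℝ → ℂ) : fcoeff f 0 = ∫ t in (0 : ℝ)..1, f t := by
  rw [fcoeff_eq]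
  simp

end Fourier

/-! ### The symplectic form on loops of mean value zero -/

section Symplectic

open Complex ComplexConjugate

/-- The `m`-th coordinate `q_m + i p_m` of the phase space, regarded as `ℂⁿ`; it turns `J` into
multiplication by `i`. -/
noncomputable def comp (m : Fin n) : Phase n →L[ℝ] ℂ :=
  (equivRealProdCLM.symm : ℝ × ℝ →L[ℝ] ℂ) ∘L
    ((EuclideanSpace.proj (𝕜 := ℝ) (Sum.inl m)).prod (EuclideanSpace.proj (𝕜 := ℝ) (Sum.inr m)))

theorem comp_re (m : Fin n) (v : Phase n) : (comp m v).re = v (Sum.inl m) := by simp [comp]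

theorem comp_im (m : Fin n) (v : Phase n) : (comp m v).im = v (Sum.inr m) := by simp [comp]

theorem comp_J (m : Fin n) (v : Phase n) : comp m (J n v) = I * comp m v := by
  apply Complex.ext <;> simp [comp_re, comp_im]

theorem inner_eq_sum_comp (u v : Phase n) :
    ⟪u, v⟫_ℝ = ∑ m, (conj (comp m u) * comp m v).re := by
  simp only [PiLp.inner_apply, Fintype.sum_sum_type, RCLike.inner_apply, RCLike.conj_to_real,
    mul_re, conj_re, conj_im, comp_re, comp_im]
  rw [← Finset.sum_add_distrib]
  exact Finset.sum_congr rfl fun m _ => by ring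

theorem memLp_of_continuousOn {E : Type*} [NormedAddCommGroup E] {f : ℝ → E}
    (hf : ContinuousOn f (Icc 0 1)) : MemLp f 2 (volume.restrict (Ioc (0 : ℝ) 1)) := by
  obtain ⟨C, hC⟩ := isCompact_Icc.exists_bound_of_continuousOn hf
  refine MemLp.of_bound ((hf.mono Ioc_subset_Icc_self).aestronglyMeasurable measurableSet_Ioc) C ?_
  exact ae_restrict_of_forall_mem measurableSet_Ioc fun t ht => hC t (Ioc_subset_Icc_self ht)

theorem memLp_coe (v : L20 n) :
    MemLp (fun t => (v : L2 n) t) 2 (volume.restrict (Ioc (0 : ℝ) 1)) := Lp.memLp _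

theorem intervalIntegrable_coe (v : L20 n) :
    IntervalIntegrable (fun t => (v : L2 n) t) volume 0 1 :=
  intervalIntegrable_of_memLp (memLp_coe v)

theorem integral_coe (v : L20 n) : ∫ t in (0 : ℝ)..1, (v : L2 n) t = 0 := by
  rw [intervalIntegral.integral_of_le zero_le_one]
  exact v.2

theorem memLp_clm {E : Type*} [NormedAddCommGroup E] [NormedSpace ℝ E] {f : ℝ → Phase n}
    (hf : MemLp f 2 (volume.restrict (Ioc (0 : ℝ) 1))) (L : Phase n →L[ℝ] E) :
    MemLp (fun t => L (f t)) 2 (volume.restrict (Ioc (0 : ℝ) 1)) :=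
  L.comp_memLp' hf

theorem memLp_prim (v : L20 n) :
    MemLp (prim (v : L2 n)) 2 (volume.restrict (Ioc (0 : ℝ) 1)) := by
  refine memLp_of_continuousOn ?_
  have := intervalIntegral.continuousOn_primitive_interval' (intervalIntegrable_coe v)
    (a := 0) (by simp)
  rw [uIcc_of_le zero_le_one] at this
  exact this.sub continuousOn_const

/-- The Fourier coefficients of a loop with mean value zero. -/
noncomputable def coeff (m : Fin n) (j : ℤ) : L20 n →ₗ[ℝ] ℂ where
  toFun v := fcoeff (fun t => comp m ((v : L2 n) t)) j
  map_add' v z := by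
    rw [← fcoeff_add (intervalIntegrable_of_memLp (memLp_clm (memLp_coe v) _))
      (intervalIntegrable_of_memLp (memLp_clm (memLp_coe z) _))]
    refine fcoeff_congr ?_ j
    filter_upwards [Lp.coeFn_add (v : L2 n) (z : L2 n)] with t ht
    rw [← map_add]
    exact congrArg (comp m) ht
  map_smul' c v := by
    rw [RingHom.id_apply, Complex.real_smul, ← fcoeff_const_mul]
    refine fcoeff_congr ?_ j
    filter_upwards [Lp.coeFn_smul c (v : L2 n)] with t ht
    rw [← Complex.real_smul, ← map_smul]
    exact congrArg (comp m) ht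

theorem coeff_zero (m : Fin n) (v : L20 n) : coeff m 0 v = 0 := by
  change fcoeff _ 0 = 0
  rw [fcoeff_zero, ContinuousLinearMap.intervalIntegral_comp_comm _ (intervalIntegrable_coe v),
    integral_coe, map_zero]

theorem fcoeff_comp_prim (m : Fin n) (v : L20 n) {j : ℤ} (hj : j ≠ 0) :
    fcoeff (fun t => comp m (prim (v : L2 n) t)) j = coeff m j v / (2 * Real.pi * j * I) := by
  have hi := intervalIntegrable_coe v
  have h0 : ∫ t in (0 : ℝ)..1, comp m ((v : L2 n) t) = 0 := by
    rw [ContinuousLinearMap.intervalIntegral_comp_comm _ hi, integral_coe, map_zero]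
  change _ = fcoeff _ j / _
  rw [← fcoeff_primitive (intervalIntegrable_of_memLp (memLp_clm (memLp_coe v) _)) h0
    (comp m (∫ σ in (0 : ℝ)..1, ∫ s in (0 : ℝ)..σ, (v : L2 n) s)) hj]
  refine fcoeff_congr (ae_restrict_of_forall_mem measurableSet_Ioc fun t ht => ?_) j
  rw [prim, map_sub, ContinuousLinearMap.intervalIntegral_comp_comm]
  refine hi.mono_set ?_
  rw [uIcc_of_le ht.1.le, uIcc_of_le zero_le_one]
  exact Icc_subset_Icc_right ht.2

/-- The symplectic part `∫₀¹ J v · M z dt` of the dual Hessian. -/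
noncomputable def symp (v z : L20 n) : ℝ :=
  ∫ t in (0 : ℝ)..1, ⟪J n ((v : L2 n) t), prim (z : L2 n) t⟫_ℝ

theorem intervalIntegrable_inner {f g : ℝ → Phase n}
    (hf : MemLp f 2 (volume.restrict (Ioc (0 : ℝ) 1)))
    (hg : MemLp g 2 (volume.restrict (Ioc (0 : ℝ) 1))) :
    IntervalIntegrable (fun t => ⟪f t, g t⟫_ℝ) volume 0 1 := by
  rw [intervalIntegrable_iff_integrableOn_Ioc_of_le zero_le_one]
  refine (hf.norm.integrable_mul hg.norm).mono (hf.1.inner hg.1) ?_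
  filter_upwards with t
  simpa using norm_inner_le_norm (𝕜 := ℝ) (f t) (g t)

/-- Parseval's identity for `ℝ²ⁿ`-valued functions. -/
theorem hasSum_inner {f g : ℝ → Phase n}
    (hf : MemLp f 2 (volume.restrict (Ioc (0 : ℝ) 1)))
    (hg : MemLp g 2 (volume.restrict (Ioc (0 : ℝ) 1))) :
    HasSum (fun j => ∑ m, (conj (fcoeff (fun t => comp m (f t)) j) *
      fcoeff (fun t => comp m (g t)) j).re) (∫ t in (0 : ℝ)..1, ⟪f t, g t⟫_ℝ) := by
  have h : ∫ t in (0 : ℝ)..1, ⟪f t, g t⟫_ℝ =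
      ∑ m, ∫ t in (0 : ℝ)..1, (conj (comp m (f t)) * comp m (g t)).re := by
    simp only [inner_eq_sum_comp]
    refine intervalIntegral.integral_finsetSum fun m _ => ?_
    rw [intervalIntegrable_iff_integrableOn_Ioc_of_le zero_le_one]
    have h1 : MemLp (fun t => conj (comp m (f t))) 2 (volume.restrict (Ioc (0 : ℝ) 1)) :=
      memLp_clm hf ((conjCLE : ℂ →L[ℝ] ℂ) ∘L comp m)
    exact (h1.integrable_mul (memLp_clm hg (comp m))).re
  rw [h]
  exact hasSum_sum fun m _ => hasSum_fcoeff (memLp_clm hf _) (memLp_clm hg _)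

/-- The symplectic part is diagonalised by the Fourier modes: on `e^{2πijt}` it is the
multiplication by `-1 / (2πj)`. -/
theorem hasSum_symp (v z : L20 n) :
    HasSum (fun j : ℤ => -(∑ m, (conj (coeff m j v) * coeff m j z).re) / (2 * Real.pi * j))
      (symp v z) := by
  have h := hasSum_inner (memLp_clm (memLp_coe v) (J n)) (memLp_prim z)
  have key : ∀ j : ℤ, ∑ m, (conj (fcoeff (fun t => comp m (J n ((v : L2 n) t))) j) *
      fcoeff (fun t => comp m (prim (z : L2 n) t)) j).re =
      -(∑ m, (conj (coeff m j v) * coeff m j z).re) / (2 * Real.pi * j) := fun j => by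
    have hJ : ∀ m, fcoeff (fun t => comp m (J n ((v : L2 n) t))) j = I * coeff m j v := fun m => by
      simp only [comp_J]
      exact fcoeff_const_mul _ _ _
    rcases eq_or_ne j 0 with rfl | hj
    · simp [hJ, coeff_zero]
    · rw [← Finset.sum_neg_distrib, Finset.sum_div]
      refine Finset.sum_congr rfl fun m _ => ?_
      have hj' : (j : ℂ) ≠ 0 := by exact_mod_cast hj
      have h1 : conj (I * coeff m j v) * (coeff m j z / (2 * Real.pi * j * I)) =
          ((-(2 * Real.pi * j)⁻¹ : ℝ) : ℂ) * (conj (coeff m j v) * coeff m j z) := by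
        have := Real.pi_ne_zero
        rw [map_mul, conj_I]
        push_cast
        field_simp
      rw [hJ, fcoeff_comp_prim m z hj, h1, re_ofReal_mul]
      ring
  simp only [key] at h
  exact h

theorem hasSum_inner_coe (v z : L20 n) :
    HasSum (fun j : ℤ => ∑ m, (conj (coeff m j v) * coeff m j z).re)
      (∫ t in (0 : ℝ)..1, ⟪(v : L2 n) t, (z : L2 n) t⟫_ℝ) :=
  hasSum_inner (memLp_coe v) (memLp_coe z)

theorem symp_comm (v z : L20 n) : symp v z = symp z v := by
  refine (hasSum_symp v z).unique ?_
  convert hasSum_symp z v using 5 with j m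
  simp only [mul_re, conj_re, conj_im]
  ring

end Symplectic

/-! ### Index and nullity of abstract forms, and the quadratic form of a frame -/

section Algebra

variable {X Y : Type*} [AddCommGroup X] [Module ℝ X] [AddCommGroup Y] [Module ℝ Y]

theorem exists_iSup_toENat_rank_eq {p : Submodule ℝ X → Prop} (h0 : p ⊥) {d : ℕ}
    (hp : ∀ V, p V → FiniteDimensional ℝ V ∧ Module.finrank ℝ V ≤ d) :
    ∃ V, p V ∧ ⨆ (V : Submodule ℝ X) (_ : p V), Cardinal.toENat (Module.rank ℝ V) =
      (Module.finrank ℝ V : ℕ∞) := by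
  set A : Set ℕ := (fun V : Submodule ℝ X => Module.finrank ℝ V) '' {V | p V}
  have hb : BddAbove A := ⟨d, by rintro _ ⟨V, hV, rfl⟩; exact (hp V hV).2⟩
  have hne : A.Nonempty := ⟨_, ⊥, h0, rfl⟩
  obtain ⟨V, hV, hVs⟩ := Nat.sSup_mem hne hb
  have hrank : ∀ W, p W → Cardinal.toENat (Module.rank ℝ W) = (Module.finrank ℝ W : ℕ∞) := by
    intro W hW
    have := (hp W hW).1
    rw [← Module.finrank_eq_rank, Cardinal.toENat_nat]
  refine ⟨V, hV, le_antisymm (iSup₂_le fun W hW => ?_) ?_⟩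
  · rw [hrank W hW]
    have : Module.finrank ℝ W ≤ Module.finrank ℝ V := by
      change _ ≤ (fun V : Submodule ℝ X => Module.finrank ℝ V) V
      rw [hVs]
      exact le_csSup hb ⟨W, hW, rfl⟩
    exact_mod_cast this
  · rw [← hrank V hV]
    exact le_iSup₂ (f := fun (V : Submodule ℝ X) (_ : p V) => Cardinal.toENat (Module.rank ℝ V)) V hV

/-- If a linear map `L` is injective on the vectors `v + s e` with `B(v, v) ≤ 0`, where
`B(e, e) > 0`, then a subspace on which `B` is nonpositive has smaller dimension than the
target of `L`. -/
theorem finrank_succ_le_of_nonpos [FiniteDimensional ℝ Y] {B : X → X → ℝ} (L : X →ₗ[ℝ] Y) {e : X}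
    (he : 0 < B e e) (hsmul : ∀ (s : ℝ) v, B (s • v) (s • v) = s ^ 2 * B v v)
    (hL : ∀ v (s : ℝ), B v v ≤ 0 → L (v + s • e) = 0 → v + s • e = 0)
    {W : Submodule ℝ X} (hW : ∀ v ∈ W, B v v ≤ 0) :
    FiniteDimensional ℝ W ∧ Module.finrank ℝ W + 1 ≤ Module.finrank ℝ Y := by
  set T : (W × ℝ) →ₗ[ℝ] Y :=
    (L ∘ₗ W.subtype).coprod (LinearMap.toSpanSingleton ℝ Y (L e)) with hT
  have hTe : ∀ q : W × ℝ, T q = L (q.1 + q.2 • e) := fun q => by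
    simp [hT]
  have hinj : Function.Injective T := by
    refine (injective_iff_map_eq_zero T).2 ?_
    rintro ⟨v, s⟩ hq
    rw [hTe] at hq
    have h0 := hL v s (hW v v.2) hq
    have hs : s = 0 := by
      by_contra hs
      have h1 : s • e ∈ W := by
        rw [← neg_eq_of_add_eq_zero_right h0]
        exact W.neg_mem v.2
      have h2 := hW _ h1
      rw [hsmul] at h2
      have : 0 < s ^ 2 * B e e := by positivity
      linarith
    subst hs
    rw [zero_smul, add_zero] at h0
    exact Prod.ext (Subtype.ext h0) rfl
  have hfin : FiniteDimensional ℝ (W × ℝ) := Module.Finite.of_injective T hinj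
  have hfW : FiniteDimensional ℝ W :=
    Module.Finite.of_injective (LinearMap.inl ℝ W ℝ) LinearMap.inl_injective
  refine ⟨hfW, ?_⟩
  have := LinearMap.finrank_le_finrank_of_injective hinj
  rwa [Module.finrank_prod, Module.finrank_self] at this

/-- A maximal negative subspace and the kernel of a symmetric form span a subspace on which the
form is nonpositive, so index and nullity are bounded together. -/
theorem exists_index_nullity [FiniteDimensional ℝ Y] {B : X → X → ℝ}
    (hadd : ∀ u v z, B (u + v) z = B u z + B v z) (hsmul : ∀ (s : ℝ) v z, B (s • v) z = s * B v z)
    (hsymm : ∀ v z, B v z = B z v) (L : X →ₗ[ℝ] Y) {e : X} (he : 0 < B e e)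
    (hL : ∀ v (s : ℝ), B v v ≤ 0 → L (v + s • e) = 0 → v + s • e = 0) :
    ∃ i ν : ℕ, formIndex B = i ∧ formNullity B = ν ∧ i + ν + 1 ≤ Module.finrank ℝ Y := by
  have h0 : ∀ z, B 0 z = 0 := fun z => by simpa using hsmul 0 0 z
  have hsq : ∀ (s : ℝ) v, B (s • v) (s • v) = s ^ 2 * B v v := fun s v => by
    rw [hsmul, hsymm, hsmul]
    ring
  have hbound := fun (W : Submodule ℝ X) (hW : ∀ v ∈ W, B v v ≤ 0) =>
    finrank_succ_le_of_nonpos L he hsq hL hW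
  have hneg : ∀ V : Submodule ℝ X, (∀ v ∈ V, v ≠ 0 → B v v < 0) → ∀ v ∈ V, B v v ≤ 0 :=
    fun V hV v hv => by
      rcases eq_or_ne v 0 with rfl | h
      · exact (h0 _).le
      · exact (hV v hv h).le
  obtain ⟨V, hV, hVi⟩ := exists_iSup_toENat_rank_eq
    (p := fun V : Submodule ℝ X => ∀ v ∈ V, v ≠ 0 → B v v < 0) (d := Module.finrank ℝ Y)
    (fun v hv h => (h ((Submodule.mem_bot ℝ).1 hv)).elim)
    (fun V hV => ⟨(hbound V (hneg V hV)).1, by have := (hbound V (hneg V hV)).2; omega⟩)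
  obtain ⟨K, hK, hKi⟩ := exists_iSup_toENat_rank_eq
    (p := fun V : Submodule ℝ X => ∀ v ∈ V, ∀ z, B v z = 0) (d := Module.finrank ℝ Y)
    (fun v hv z => by rw [(Submodule.mem_bot ℝ).1 hv, h0])
    (fun V hV => ⟨(hbound V fun v hv => (hV v hv v).le).1, by
      have := (hbound V fun v hv => (hV v hv v).le).2
      omega⟩)
  refine ⟨_, _, hVi, hKi, ?_⟩
  have h1 := hbound (V ⊔ K) fun z hz => by
    obtain ⟨v, hv, k, hk, rfl⟩ := Submodule.mem_sup.1 hz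
    rw [hadd, hK k hk, hsymm, hadd, hK k hk, add_zero, add_zero]
    exact hneg V hV v hv
  have h2 : V ⊓ K = ⊥ := by
    refine (Submodule.eq_bot_iff _).2 fun v hv => ?_
    by_contra h
    have := hV v hv.1 h
    rw [hK v hv.2] at this
    exact lt_irrefl _ this
  have := (hbound V (hneg V hV)).1
  have := (hbound K fun v hv => (hK v hv v).le).1
  have h3 := Submodule.finrank_sup_add_finrank_inf_eq V K
  rw [h2, finrank_bot, add_zero] at h3
  omega

end Algebra

section FrameForm

/-- The operator `τ⁻¹ (S⁻¹ + κ w ⊗ w)`. For `κ = (2 - α) / (α - 1)` it is the Hessian of `H_α^*`,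
for `κ = 0` that of `H₂^*`. -/
noncomputable def dualOp (τ : ℝ) (w : ℝ → Phase n) (S : ℝ → Phase n →L[ℝ] Phase n) (κ t : ℝ) :
    Phase n →L[ℝ] Phase n :=
  τ⁻¹ • (Ring.inverse (S t) + κ • (innerSL ℝ (w t)).smulRight (w t))

/-- The quadratic form `∫₀¹ (J v · M z + B J v · J z) dt` with `B = τ⁻¹ (S⁻¹ + κ w ⊗ w)`. -/
noncomputable def frameForm (τ : ℝ) (w : ℝ → Phase n) (S : ℝ → Phase n →L[ℝ] Phase n) (κ : ℝ)
    (v z : L20 n) : ℝ :=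
  symp v z + ∫ t in (0 : ℝ)..1, ⟪dualOp τ w S κ t (J n ((v : L2 n) t)), J n ((z : L2 n) t)⟫_ℝ

variable {τ r R : ℝ} {w N : ℝ → Phase n} {S : ℝ → Phase n →L[ℝ] Phase n}

theorem inner_dualOp (κ t : ℝ) (u v : Phase n) : ⟪dualOp τ w S κ t u, v⟫_ℝ =
    τ⁻¹ * (⟪Ring.inverse (S t) u, v⟫_ℝ + κ * (⟪w t, u⟫_ℝ * ⟪w t, v⟫_ℝ)) := by
  change ⟪τ⁻¹ • (Ring.inverse (S t) u + κ • ⟪w t, u⟫_ℝ • w t), v⟫_ℝ = _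
  rw [real_inner_smul_left, inner_add_left, real_inner_smul_left, real_inner_smul_left]

theorem memLp_J (v : L20 n) :
    MemLp (fun t => J n ((v : L2 n) t)) 2 (volume.restrict (Ioc (0 : ℝ) 1)) :=
  memLp_clm (memLp_coe v) (J n)

namespace IsFrame

theorem continuous_curve (h : IsFrame τ r R w N S) : Continuous w :=
  continuous_iff_continuousAt.2 fun t => (h.hasDerivAt t).continuousAt

theorem continuous_normal (h : IsFrame τ r R w N S) : Continuous N :=
  continuous_iff_continuousAt.2 fun t => (h.hasDerivAt_normal t).continuousAt

theorem continuous_dualOp (h : IsFrame τ r R w N S) (κ : ℝ) : Continuous (dualOp τ w S κ) := by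
  have h1 := h.continuous_inverse
  have h2 := h.continuous_curve
  have h3 : Continuous fun t => (innerSL ℝ (w t)).smulRight (w t) := by
    have : Continuous fun t => ContinuousLinearMap.smulRightL ℝ (Phase n) (Phase n)
        (innerSL ℝ (w t)) (w t) := by fun_prop
    exact this
  exact (h1.add (h3.const_smul κ)).const_smul τ⁻¹

theorem memLp_dualOp (h : IsFrame τ r R w N S) (κ : ℝ) {f : ℝ → Phase n}
    (hf : MemLp f 2 (volume.restrict (Ioc (0 : ℝ) 1))) :
    MemLp (fun t => dualOp τ w S κ t (f t)) 2 (volume.restrict (Ioc (0 : ℝ) 1)) := by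
  obtain ⟨C, hC⟩ := isCompact_Icc.exists_bound_of_continuousOn
    (h.continuous_dualOp κ).continuousOn (s := Icc (0 : ℝ) 1)
  refine hf.of_le_mul (c := C) ?_ (ae_restrict_of_forall_mem measurableSet_Ioc fun t ht => ?_)
  · exact isBoundedBilinearMap_apply.continuous.comp_aestronglyMeasurable
      ((h.continuous_dualOp κ).aestronglyMeasurable.prodMk hf.1)
  · exact (ContinuousLinearMap.le_opNorm _ _).trans
      (by gcongr; exact hC t (Ioc_subset_Icc_self ht))

theorem intervalIntegrable_dualOp (h : IsFrame τ r R w N S) (κ : ℝ) (v z : L20 n) :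
    IntervalIntegrable (fun t => ⟪dualOp τ w S κ t (J n ((v : L2 n) t)), J n ((z : L2 n) t)⟫_ℝ)
      volume 0 1 :=
  intervalIntegrable_inner (h.memLp_dualOp κ (memLp_J v)) (memLp_J z)

theorem frameForm_eq_integral (h : IsFrame τ r R w N S) (κ : ℝ) (v z : L20 n) :
    frameForm τ w S κ v z = ∫ t in (0 : ℝ)..1, (⟪J n ((v : L2 n) t), prim (z : L2 n) t⟫_ℝ +
      ⟪dualOp τ w S κ t (J n ((v : L2 n) t)), J n ((z : L2 n) t)⟫_ℝ) :=
  (intervalIntegral.integral_add (intervalIntegrable_inner (memLp_J v) (memLp_prim z))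
    (h.intervalIntegrable_dualOp κ v z)).symm

theorem frameForm_comm (h : IsFrame τ r R w N S) (κ : ℝ) (v z : L20 n) :
    frameForm τ w S κ v z = frameForm τ w S κ z v := by
  rw [frameForm, frameForm, symp_comm]
  congr 1
  refine intervalIntegral.integral_congr fun t _ => ?_
  simp only [inner_dualOp]
  rw [h.inverse_symm, real_inner_comm, mul_comm ⟪w t, _⟫_ℝ]

theorem frameForm_add_left (h : IsFrame τ r R w N S) (κ : ℝ) (u v z : L20 n) :
    frameForm τ w S κ (u + v) z = frameForm τ w S κ u z + frameForm τ w S κ v z := by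
  rw [h.frameForm_eq_integral, h.frameForm_eq_integral, h.frameForm_eq_integral,
    ← intervalIntegral.integral_add]
  · refine intervalIntegral.integral_congr_ae_restrict ?_
    rw [uIoc_of_le zero_le_one]
    filter_upwards [Lp.coeFn_add (u : L2 n) (v : L2 n)] with t ht
    have ht' : ((u + v : L20 n) : L2 n) t = (u : L2 n) t + (v : L2 n) t := ht
    rw [ht', map_add, map_add, inner_add_left, inner_add_left]
    ring
  · exact (intervalIntegrable_inner (memLp_J u) (memLp_prim z)).add
      (h.intervalIntegrable_dualOp κ u z)
  · exact (intervalIntegrable_inner (memLp_J v) (memLp_prim z)).add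
      (h.intervalIntegrable_dualOp κ v z)

theorem frameForm_smul_left (h : IsFrame τ r R w N S) (κ s : ℝ) (v z : L20 n) :
    frameForm τ w S κ (s • v) z = s * frameForm τ w S κ v z := by
  rw [h.frameForm_eq_integral, h.frameForm_eq_integral, ← intervalIntegral.integral_const_mul]
  refine intervalIntegral.integral_congr_ae_restrict ?_
  rw [uIoc_of_le zero_le_one]
  filter_upwards [Lp.coeFn_smul s (v : L2 n)] with t ht
  have ht' : ((s • v : L20 n) : L2 n) t = s • (v : L2 n) t := ht
  rw [ht', map_smul, map_smul, real_inner_smul_left, real_inner_smul_left]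
  ring

theorem frameForm_zero_le (h : IsFrame τ r R w N S) {κ : ℝ} (hκ : 0 ≤ κ) (v : L20 n) :
    frameForm τ w S 0 v v ≤ frameForm τ w S κ v v := by
  refine add_le_add_right (intervalIntegral.integral_mono_on zero_le_one
    (h.intervalIntegrable_dualOp 0 v v) (h.intervalIntegrable_dualOp κ v v) fun t _ => ?_) _
  have := h.τ_pos
  simp only [inner_dualOp]
  gcongr
  nlinarith [mul_self_nonneg ⟪w t, J n ((v : L2 n) t)⟫_ℝ]

theorem le_frameForm (h : IsFrame τ r R w N S) (v : L20 n) :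
    symp v v + r ^ 2 / τ * ∫ t in (0 : ℝ)..1, ⟪(v : L2 n) t, (v : L2 n) t⟫_ℝ ≤
      frameForm τ w S 0 v v := by
  rw [frameForm, ← intervalIntegral.integral_const_mul]
  refine add_le_add_right (intervalIntegral.integral_mono_on zero_le_one
    ((intervalIntegrable_inner (memLp_coe v) (memLp_coe v)).const_mul _)
    (h.intervalIntegrable_dualOp 0 v v) fun t _ => ?_) _
  have h1 := h.le_inverse t (J n ((v : L2 n) t))
  rw [← real_inner_self_eq_norm_sq, inner_J_J] at h1
  have h2 := h.τ_pos
  rw [inner_dualOp, zero_mul, add_zero, div_mul_eq_mul_div, div_eq_inv_mul]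
  gcongr

end IsFrame

/-- The velocity of a closed curve of class `C¹`, as an element of `L₀²`. -/
noncomputable def velocity {φ φ' : ℝ → Phase n} (hφ : ∀ t, HasDerivAt φ (φ' t) t)
    (hc : Continuous φ') (h1 : φ 1 = φ 0) : L20 n :=
  ⟨(memLp_of_continuousOn hc.continuousOn).toLp φ', by
    change ∫ t in Ioc (0 : ℝ) 1, ((memLp_of_continuousOn hc.continuousOn).toLp φ') t = 0
    rw [integral_congr_ae (MemLp.coeFn_toLp _), ← intervalIntegral.integral_of_le zero_le_one,
      intervalIntegral.integral_eq_sub_of_hasDerivAt (fun t _ => hφ t)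
        (hc.intervalIntegrable _ _), h1, sub_self]⟩

section Velocity

variable {φ φ' ψ ψ' : ℝ → Phase n}

theorem coe_velocity (hφ : ∀ t, HasDerivAt φ (φ' t) t) (hc : Continuous φ') (h1 : φ 1 = φ 0) :
    (fun t => (velocity hφ hc h1 : L2 n) t) =ᵐ[volume.restrict (Ioc (0 : ℝ) 1)] φ' :=
  MemLp.coeFn_toLp (memLp_of_continuousOn hc.continuousOn)

theorem prim_velocity (hφ : ∀ t, HasDerivAt φ (φ' t) t) (hc : Continuous φ') (h1 : φ 1 = φ 0)
    {t : ℝ} (ht : t ∈ Icc (0 : ℝ) 1) :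
    prim (velocity hφ hc h1 : L2 n) t = φ t - ∫ σ in (0 : ℝ)..1, φ σ := by
  have hφc : Continuous φ := continuous_iff_continuousAt.2 fun t => (hφ t).continuousAt
  have key : ∀ σ ∈ Icc (0 : ℝ) 1,
      ∫ s in (0 : ℝ)..σ, (velocity hφ hc h1 : L2 n) s = φ σ - φ 0 := fun σ hσ => by
    rw [← intervalIntegral.integral_eq_sub_of_hasDerivAt (fun t _ => hφ t)
        (hc.intervalIntegrable _ _)]
    refine intervalIntegral.integral_congr_ae_restrict ?_
    rw [uIoc_of_le hσ.1]
    exact ae_restrict_of_ae_restrict_of_subset (Ioc_subset_Ioc_right hσ.2) (coe_velocity hφ hc h1)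
  have key2 : ∫ σ in (0 : ℝ)..1, ∫ s in (0 : ℝ)..σ, (velocity hφ hc h1 : L2 n) s =
      (∫ σ in (0 : ℝ)..1, φ σ) - φ 0 := by
    rw [intervalIntegral.integral_congr (g := fun σ => φ σ - φ 0)
      (fun σ hσ => key σ (by rwa [uIcc_of_le zero_le_one] at hσ)),
      intervalIntegral.integral_sub (hφc.intervalIntegrable _ _) intervalIntegrable_const]
    simp
  rw [prim, key t ht, key2]
  abel

theorem symp_velocity (v : L20 n) (hφ : ∀ t, HasDerivAt φ (φ' t) t) (hc : Continuous φ')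
    (h1 : φ 1 = φ 0) :
    symp v (velocity hφ hc h1) = ∫ t in (0 : ℝ)..1, ⟪J n ((v : L2 n) t), φ t⟫_ℝ := by
  have hφc : Continuous φ := continuous_iff_continuousAt.2 fun t => (hφ t).continuousAt
  have hi : IntervalIntegrable (fun t => J n ((v : L2 n) t)) volume 0 1 :=
    intervalIntegrable_of_memLp (memLp_clm (memLp_coe v) _)
  set c := ∫ σ in (0 : ℝ)..1, φ σ with hcdef
  have h2 : symp v (velocity hφ hc h1) =
      ∫ t in (0 : ℝ)..1, (⟪J n ((v : L2 n) t), φ t⟫_ℝ - ⟪J n ((v : L2 n) t), c⟫_ℝ) := by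
    refine intervalIntegral.integral_congr fun t ht => ?_
    rw [uIcc_of_le zero_le_one] at ht
    rw [prim_velocity hφ hc h1 ht, inner_sub_right]
  have h3 : ∫ t in (0 : ℝ)..1, ⟪J n ((v : L2 n) t), c⟫_ℝ = 0 := by
    have h4 := (innerSL ℝ c).intervalIntegral_comp_comm hi
    have h5 := (J n).intervalIntegral_comp_comm (intervalIntegrable_coe v)
    rw [integral_coe, map_zero] at h5
    rw [h5, map_zero] at h4
    simpa only [innerSL_apply_apply, real_inner_comm c] using h4
  rw [h2, intervalIntegral.integral_sub, h3, sub_zero]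
  · exact intervalIntegrable_inner (memLp_clm (memLp_coe v) _)
      (memLp_of_continuousOn hφc.continuousOn)
  · exact intervalIntegrable_inner (memLp_clm (memLp_coe v) _)
      (memLp_of_continuousOn continuousOn_const)

theorem frameForm_velocity (h : IsFrame τ r R w N S) (κ : ℝ) (v : L20 n)
    (hφ : ∀ t, HasDerivAt φ (φ' t) t) (hc : Continuous φ') (h1 : φ 1 = φ 0) :
    frameForm τ w S κ v (velocity hφ hc h1) = ∫ t in (0 : ℝ)..1,
      (⟪J n ((v : L2 n) t), φ t⟫_ℝ + ⟪J n ((v : L2 n) t), dualOp τ w S κ t (J n (φ' t))⟫_ℝ) := by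
  have hφc : Continuous φ := continuous_iff_continuousAt.2 fun t => (hφ t).continuousAt
  rw [frameForm, symp_velocity, ← intervalIntegral.integral_add]
  · refine intervalIntegral.integral_congr_ae_restrict ?_
    rw [uIoc_of_le zero_le_one]
    filter_upwards [coe_velocity hφ hc h1] with t ht
    rw [ht]
    congr 1
    rw [real_inner_comm _ (J n _), inner_dualOp, inner_dualOp, h.inverse_symm, real_inner_comm,
      mul_comm ⟪w t, _⟫_ℝ]
  · exact intervalIntegrable_inner (memLp_clm (memLp_coe v) _)
      (memLp_of_continuousOn hφc.continuousOn)
  · exact h.intervalIntegrable_dualOp κ v _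

end Velocity

end FrameForm

/-! ### The upper bound for index and nullity -/

section UpperBound

open ComplexConjugate

variable {τ r R : ℝ} {w N : ℝ → Phase n} {S : ℝ → Phase n →L[ℝ] Phase n}

theorem dualOp_normal (h : IsFrame τ r R w N S) (κ t : ℝ) :
    dualOp τ w S κ t (τ • N t) = (1 + κ) • w t := by
  have hτ := h.τ_pos.ne'
  change τ⁻¹ • (Ring.inverse (S t) (τ • N t) + κ • ⟪w t, τ • N t⟫_ℝ • w t) = _
  rw [map_smul, h.inverse_normal, real_inner_smul_right, real_inner_comm, h.inner_eq_one]
  match_scalars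
  field_simp

theorem J_velocity (t : ℝ) : J n (τ • J n (N t)) = -(τ • N t) := by
  rw [map_smul, J_J, smul_neg]

theorem IsFrame.continuous_velocity (h : IsFrame τ r R w N S) :
    Continuous fun t => τ • J n (N t) :=
  ((J n).continuous.comp h.continuous_normal).const_smul τ

/-- The velocity of the orbit itself, the direction of the time shifts. -/
noncomputable def IsFrame.orbitVelocity (h : IsFrame τ r R w N S) : L20 n :=
  velocity h.hasDerivAt h.continuous_velocity h.closed

theorem frameForm_orbitVelocity (h : IsFrame τ r R w N S) (κ : ℝ) (v : L20 n) :
    frameForm τ w S κ v h.orbitVelocity =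
      -(κ * ∫ t in (0 : ℝ)..1, ⟪J n ((v : L2 n) t), w t⟫_ℝ) := by
  rw [IsFrame.orbitVelocity, frameForm_velocity h, ← intervalIntegral.integral_const_mul,
    ← intervalIntegral.integral_neg]
  refine intervalIntegral.integral_congr fun t _ => ?_
  rw [J_velocity, map_neg, dualOp_normal h, inner_neg_right, real_inner_smul_right]
  ring

theorem frameForm_zero_orbitVelocity (h : IsFrame τ r R w N S) (v : L20 n) :
    frameForm τ w S 0 v h.orbitVelocity = 0 := by
  rw [frameForm_orbitVelocity, zero_mul, neg_zero]

theorem frameForm_orbitVelocity_self (h : IsFrame τ r R w N S) (κ : ℝ) :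
    frameForm τ w S κ h.orbitVelocity h.orbitVelocity = κ * τ := by
  have h1 : ∫ t in (0 : ℝ)..1, ⟪J n ((h.orbitVelocity : L2 n) t), w t⟫_ℝ =
      ∫ _t in (0 : ℝ)..1, -τ := by
    refine intervalIntegral.integral_congr_ae_restrict ?_
    rw [uIoc_of_le zero_le_one]
    filter_upwards [coe_velocity h.hasDerivAt h.continuous_velocity h.closed] with t ht
    rw [IsFrame.orbitVelocity, ht, J_velocity, inner_neg_left, real_inner_smul_left,
      h.inner_eq_one, mul_one]
  rw [frameForm_orbitVelocity, h1]
  simp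

theorem frameForm_zero_add_smul (h : IsFrame τ r R w N S) (v : L20 n) (s : ℝ) :
    frameForm τ w S 0 (v + s • h.orbitVelocity) (v + s • h.orbitVelocity) =
      frameForm τ w S 0 v v := by
  have h1 : ∀ z, frameForm τ w S 0 (s • h.orbitVelocity) z = 0 := fun z => by
    rw [h.frameForm_smul_left, h.frameForm_comm, frameForm_zero_orbitVelocity, mul_zero]
  rw [h.frameForm_add_left, h1, add_zero, h.frameForm_comm, h.frameForm_add_left, h1, add_zero]

/-- The form `∫₀¹ (J v · M v + b |v|²) dt` is positive off the span of the modes `e^{2πijt}` with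
`1 ≤ j ≤ K`, provided that `b > 1 / (2π (K + 1))`. -/
theorem eq_zero_of_coeff_eq_zero {b : ℝ} {K : ℕ} (hb : 1 < b * (2 * Real.pi * (K + 1)))
    {v : L20 n} (hv : symp v v + b * ∫ t in (0 : ℝ)..1, ⟪(v : L2 n) t, (v : L2 n) t⟫_ℝ ≤ 0)
    (hcoeff : ∀ m (j : Fin K), coeff m ((j : ℤ) + 1) v = 0) : v = 0 := by
  set a : ℤ → ℝ := fun j => ∑ m, (conj (coeff m j v) * coeff m j v).re with ha
  have hsq : ∀ m j, (conj (coeff m j v) * coeff m j v).re = ‖coeff m j v‖ ^ 2 := fun m j => by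
    rw [← Complex.normSq_eq_conj_mul_self, Complex.ofReal_re, Complex.normSq_eq_norm_sq]
  have ha0 : ∀ j, 0 ≤ a j := fun j => Finset.sum_nonneg fun m _ => by rw [hsq]; positivity
  have hsum := (hasSum_symp v v).add ((hasSum_inner_coe v v).mul_left b)
  have hpi := Real.pi_pos
  have hb0 : 0 < b := by
    by_contra hcon
    push Not at hcon
    have : b * (2 * Real.pi * (K + 1)) ≤ 0 := mul_nonpos_of_nonpos_of_nonneg hcon (by positivity)
    linarith
  -- each mode contributes a positive multiple of its squared amplitude
  have hpos : ∀ j : ℤ, a j = 0 ∨ 0 < b - 1 / (2 * Real.pi * j) := fun j => by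
    rcases le_or_gt j 0 with hj | hj
    · right
      have h1 : (j : ℝ) ≤ 0 := by exact_mod_cast hj
      have : 1 / (2 * Real.pi * j) ≤ 0 :=
        div_nonpos_of_nonneg_of_nonpos zero_le_one
          (mul_nonpos_of_nonneg_of_nonpos (by positivity) h1)
      linarith
    · rcases le_or_gt j K with hjK | hjK
      · left
        refine Finset.sum_eq_zero fun m _ => ?_
        have h1 := hcoeff m ⟨(j - 1).toNat, by omega⟩
        have h2 : (((j - 1).toNat : ℤ) + 1) = j := by omega
        rw [h2] at h1
        rw [h1, mul_zero, Complex.zero_re]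
      · right
        have h1 : (K : ℝ) + 1 ≤ j := by exact_mod_cast hjK
        have h2 : (0 : ℝ) < j := by exact_mod_cast hj
        rw [sub_pos, div_lt_iff₀ (by positivity)]
        refine hb.trans_le ?_
        gcongr
  have hterm : ∀ j : ℤ, -(∑ m, (conj (coeff m j v) * coeff m j v).re) / (2 * Real.pi * j) +
      b * ∑ m, (conj (coeff m j v) * coeff m j v).re = (b - 1 / (2 * Real.pi * j)) * a j :=
    fun j => by rw [ha]; ring
  simp only [hterm] at hsum
  have hnn : ∀ j, 0 ≤ (b - 1 / (2 * Real.pi * j)) * a j := fun j => by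
    rcases hpos j with h | h
    · rw [h, mul_zero]
    · exact mul_nonneg h.le (ha0 j)
  have hzero : (fun j : ℤ => (b - 1 / (2 * Real.pi * j)) * a j) = 0 := by
    have := le_antisymm hv (hsum.nonneg hnn)
    rw [this] at hsum
    exact (hasSum_zero_iff_of_nonneg hnn).1 hsum
  have hall : ∀ j, a j = 0 := fun j => by
    rcases hpos j with h | h
    · exact h
    · exact (mul_eq_zero.1 (congrFun hzero j)).resolve_left h.ne'
  have hint : ∫ t in (0 : ℝ)..1, ⟪(v : L2 n) t, (v : L2 n) t⟫_ℝ = 0 := by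
    refine (hasSum_inner_coe v v).unique ?_
    have : (fun j => ∑ m, (conj (coeff m j v) * coeff m j v).re) = 0 := funext hall
    rw [this]
    exact hasSum_zero
  rw [intervalIntegral.integral_of_le zero_le_one] at hint
  have h3 : ⟪(v : L2 n), (v : L2 n)⟫_ℝ = 0 := by
    rw [MeasureTheory.L2.inner_def]
    exact hint
  exact Subtype.ext (inner_self_eq_zero.1 h3)

/-- The upper bound for index and nullity. -/
theorem IsFrame.exists_index_nullity (h : IsFrame τ r R w N S) {κ : ℝ} (hκ : 0 < κ) {K : ℕ}
    (hK : τ / 2 < (K + 1) * Real.pi * r ^ 2) :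
    ∃ i ν : ℕ, formIndex (frameForm τ w S κ) = i ∧ formNullity (frameForm τ w S κ) = ν ∧
      i + ν + 1 ≤ 2 * n * K := by
  have hτ := h.τ_pos
  set L : L20 n →ₗ[ℝ] (Fin n × Fin K → ℂ) :=
    LinearMap.pi fun p => coeff p.1 ((p.2 : ℤ) + 1) with hL
  have hfin : Module.finrank ℝ (Fin n × Fin K → ℂ) = 2 * n * K := by
    rw [Module.finrank_pi_fintype]
    simp [Complex.finrank_real_complex]
    ring
  rw [← hfin]
  refine ClosedChar.exists_index_nullity (h.frameForm_add_left κ) (h.frameForm_smul_left κ)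
    (h.frameForm_comm κ) L (e := h.orbitVelocity) ?_ fun v s hv hLv => ?_
  · rw [frameForm_orbitVelocity_self]
    positivity
  · refine eq_zero_of_coeff_eq_zero (b := r ^ 2 / τ) (K := K) ?_ ?_
      fun m j => congrFun hLv (m, j)
    · rw [div_mul_eq_mul_div, lt_div_iff₀ hτ]
      linarith
    · refine (h.le_frameForm _).trans ?_
      rw [frameForm_zero_add_smul]
      exact (h.frameForm_zero_le hκ.le v).trans hv

end UpperBound

/-! ### Trigonometric polynomials -/

section Modes

/-- The rotation `e^{θJ}`. -/
noncomputable def rot (θ : ℝ) (v : Phase n) : Phase n := Real.cos θ • v + Real.sin θ • J n v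

theorem rot_add (θ : ℝ) (u v : Phase n) : rot θ (u + v) = rot θ u + rot θ v := by
  simp only [rot, map_add, smul_add]
  abel

theorem rot_smul (θ c : ℝ) (v : Phase n) : rot θ (c • v) = c • rot θ v := by
  simp only [rot, map_smul, smul_add, smul_comm c]

theorem inner_rot (θ φ : ℝ) (u v : Phase n) : ⟪rot θ u, rot φ v⟫_ℝ =
    Real.cos (θ - φ) * ⟪u, v⟫_ℝ + Real.sin (θ - φ) * ⟪J n u, v⟫_ℝ := by
  have h : ⟪u, J n v⟫_ℝ = -⟪J n u, v⟫_ℝ := by rw [inner_J_left, neg_neg]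
  simp only [rot, inner_add_left, inner_add_right, real_inner_smul_left, real_inner_smul_right,
    inner_J_J, h, Real.cos_sub, Real.sin_sub]
  ring

theorem hasDerivAt_rot (a : ℝ) (v : Phase n) (t : ℝ) :
    HasDerivAt (fun t => rot (a * t) v) (a • J n (rot (a * t) v)) t := by
  have h0 : HasDerivAt (fun t => a * t) a t := by simpa using (hasDerivAt_id t).const_mul a
  have h := ((h0.cos).smul_const v).add ((h0.sin).smul_const (J n v))
  refine h.congr_deriv ?_
  simp only [rot, map_add, map_smul, J_J]
  match_scalars <;> ring

theorem integral_cos_int (m : ℤ) :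
    ∫ t in (0 : ℝ)..1, Real.cos (2 * Real.pi * m * t) = if m = 0 then 1 else 0 := by
  split_ifs with hm
  · simp [hm]
  · have hc : (2 * Real.pi * m : ℝ) ≠ 0 := by
      simp [Real.pi_ne_zero, hm]
    rw [intervalIntegral.integral_comp_mul_left (fun x => Real.cos x) hc, integral_cos, mul_one,
      mul_zero, Real.sin_zero, show (2 * Real.pi * m : ℝ) = (2 * m : ℤ) * Real.pi by
        push_cast; ring, Real.sin_int_mul_pi]
    simp

theorem integral_sin_int (m : ℤ) : ∫ t in (0 : ℝ)..1, Real.sin (2 * Real.pi * m * t) = 0 := by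
  rcases eq_or_ne m 0 with rfl | hm
  · simp
  · have hc : (2 * Real.pi * m : ℝ) ≠ 0 := by
      simp [Real.pi_ne_zero, hm]
    rw [intervalIntegral.integral_comp_mul_left (fun x => Real.sin x) hc, integral_sin, mul_one,
      mul_zero, Real.cos_zero, show (2 * Real.pi * m : ℝ) = m * (2 * Real.pi) by ring,
      Real.cos_int_mul_two_pi]
    simp

variable {k : ℕ}

/-- The frequency `2π(j+1)` of the `j`-th mode. -/
noncomputable def freq (j : Fin k) : ℝ := 2 * Real.pi * ((j : ℤ) + 1 : ℤ)

theorem freq_pos (j : Fin k) : 0 < freq j := by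
  have : (0 : ℝ) < ((j : ℤ) + 1 : ℤ) := by positivity
  have := Real.pi_pos
  unfold freq
  positivity

/-- The trigonometric polynomial `∑ⱼ e^{2πjtJ} ξⱼ`, where `1 ≤ j ≤ k`. -/
noncomputable def trigPoly (ξ : Fin k → Phase n) (t : ℝ) : Phase n :=
  ∑ j, rot (freq j * t) (ξ j)

/-- The primitive of `trigPoly ξ` with mean value zero. -/
noncomputable def trigPrim (ξ : Fin k → Phase n) (t : ℝ) : Phase n :=
  ∑ j, -((freq j)⁻¹ • J n (rot (freq j * t) (ξ j)))

theorem hasDerivAt_trigPrim (ξ : Fin k → Phase n) (t : ℝ) :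
    HasDerivAt (trigPrim ξ) (trigPoly ξ t) t := by
  refine HasDerivAt.fun_sum fun j _ => ?_
  have h := (((J n).hasFDerivAt.comp_hasDerivAt t
    (hasDerivAt_rot (freq j) (ξ j) t)).const_smul (freq j)⁻¹).neg
  refine h.congr_deriv ?_
  rw [map_smul, J_J, inv_smul_smul₀ (freq_pos j).ne', neg_neg]

theorem continuous_trigPoly (ξ : Fin k → Phase n) : Continuous (trigPoly ξ) :=
  continuous_finsetSum _ fun j _ =>
    continuous_iff_continuousAt.2 fun t => (hasDerivAt_rot (freq j) (ξ j) t).continuousAt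

theorem rot_freq (j : Fin k) (v : Phase n) : rot (freq j) v = v := by
  have h1 : freq j = (((j : ℤ) + 1 : ℤ) : ℝ) * (2 * Real.pi) := by rw [freq]; ring
  have h2 : Real.sin (freq j) = 0 := by
    rw [h1, show (((j : ℤ) + 1 : ℤ) : ℝ) * (2 * Real.pi) = (2 * ((j : ℤ) + 1) : ℤ) * Real.pi by
      push_cast; ring, Real.sin_int_mul_pi]
  rw [rot, h2, h1, Real.cos_int_mul_two_pi]
  simp

theorem trigPrim_closed (ξ : Fin k → Phase n) : trigPrim ξ 1 = trigPrim ξ 0 := by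
  simp only [trigPrim, mul_one, mul_zero, rot_freq]
  simp [rot]

theorem integral_inner_rot (j l : Fin k) (u v : Phase n) :
    ∫ t in (0 : ℝ)..1, ⟪rot (freq j * t) u, rot (freq l * t) v⟫_ℝ =
      if j = l then ⟪u, v⟫_ℝ else 0 := by
  have h : ∀ t, freq j * t - freq l * t = 2 * Real.pi * (((j : ℤ) - l : ℤ) : ℝ) * t := fun t => by
    simp only [freq]
    push_cast
    ring
  simp only [inner_rot, h]
  rw [intervalIntegral.integral_add (Continuous.intervalIntegrable (by fun_prop) _ _)
    (Continuous.intervalIntegrable (by fun_prop) _ _), intervalIntegral.integral_mul_const,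
    intervalIntegral.integral_mul_const, integral_cos_int, integral_sin_int]
  have h2 : ((j : ℤ) - l = 0) ↔ j = l := by
    rw [sub_eq_zero, Fin.ext_iff]
    exact Int.ofNat_inj
  simp [h2]

theorem continuous_rot (j : Fin k) (v : Phase n) : Continuous fun t => rot (freq j * t) v :=
  continuous_iff_continuousAt.2 fun t => (hasDerivAt_rot (freq j) v t).continuousAt

/-- The comparison form is diagonal on trigonometric polynomials. -/
theorem integral_trigPoly (b : ℝ) (ξ : Fin k → Phase n) :
    ∫ t in (0 : ℝ)..1, (⟪J n (trigPoly ξ t), trigPrim ξ t⟫_ℝ +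
      b * ⟪trigPoly ξ t, trigPoly ξ t⟫_ℝ) = ∑ j, (b - (freq j)⁻¹) * ‖ξ j‖ ^ 2 := by
  have h1 : ∀ t, ⟪J n (trigPoly ξ t), trigPrim ξ t⟫_ℝ + b * ⟪trigPoly ξ t, trigPoly ξ t⟫_ℝ =
      ∑ j, ∑ l, (b - (freq j)⁻¹) * ⟪rot (freq l * t) (ξ l), rot (freq j * t) (ξ j)⟫_ℝ := fun t => by
    simp only [trigPoly, trigPrim, map_sum, sum_inner, inner_sum, inner_neg_right,
      real_inner_smul_right, inner_J_J, Finset.mul_sum]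
    rw [← Finset.sum_add_distrib]
    refine Finset.sum_congr rfl fun j _ => ?_
    rw [← Finset.sum_neg_distrib, ← Finset.sum_add_distrib]
    exact Finset.sum_congr rfl fun l _ => by ring
  have hc : ∀ j l, Continuous fun t => ⟪rot (freq j * t) (ξ j), rot (freq l * t) (ξ l)⟫_ℝ :=
    fun j l => (continuous_rot j (ξ j)).inner (continuous_rot l (ξ l))
  simp only [h1]
  rw [intervalIntegral.integral_finsetSum fun j _ => (continuous_finsetSum _ fun l _ =>
    (hc l j).const_mul _).intervalIntegrable _ _]
  refine Finset.sum_congr rfl fun j _ => ?_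
  rw [intervalIntegral.integral_finsetSum fun l _ => ((hc l j).const_mul _).intervalIntegrable _ _]
  simp only [intervalIntegral.integral_const_mul, integral_inner_rot]
  simp

theorem integral_trigPoly_neg {b : ℝ} (hb : b * (2 * Real.pi * k) < 1) {ξ : Fin k → Phase n}
    (hξ : ξ ≠ 0) :
    ∫ t in (0 : ℝ)..1, (⟪J n (trigPoly ξ t), trigPrim ξ t⟫_ℝ +
      b * ⟪trigPoly ξ t, trigPoly ξ t⟫_ℝ) < 0 := by
  rw [integral_trigPoly]
  have hneg : ∀ j : Fin k, b - (freq j)⁻¹ < 0 := fun j => by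
    have h1 := freq_pos j
    rw [sub_neg, ← one_div, lt_div_iff₀ h1]
    rcases le_or_gt b 0 with h | h
    · exact (mul_nonpos_of_nonpos_of_nonneg h h1.le).trans_lt one_pos
    · refine lt_of_le_of_lt ?_ hb
      have h2 : (((j : ℤ) + 1 : ℤ) : ℝ) ≤ k := by exact_mod_cast j.2
      have := Real.pi_pos
      unfold freq
      gcongr
  obtain ⟨j, hj⟩ := Function.ne_iff.1 hξ
  have hj' : ξ j ≠ 0 := hj
  refine Finset.sum_neg' (fun j _ => ?_) ⟨j, Finset.mem_univ j, ?_⟩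
  · exact mul_nonpos_of_nonpos_of_nonneg (hneg j).le (by positivity)
  · exact mul_neg_of_neg_of_pos (hneg j) (by positivity)

end Modes

/-! ### The lower bound for the index -/

section Shift

/-- The function `p = τ⁻¹ w · J v`. The velocity `v` is corrected by a time shift of variable speed,
chosen such that the corrected velocity satisfies `w · J v = 0`. -/
noncomputable def shiftRate (τ : ℝ) (w v : ℝ → Phase n) (t : ℝ) : ℝ := τ⁻¹ * ⟪w t, J n (v t)⟫_ℝ

/-- The mean value of the shift rate. -/
noncomputable def shiftMean (τ : ℝ) (w v : ℝ → Phase n) : ℝ := ∫ t in (0 : ℝ)..1, shiftRate τ w v t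

/-- The periodic primitive `g`, vanishing at `0`, of the shift rate minus its mean value. -/
noncomputable def shiftAmp (τ : ℝ) (w v : ℝ → Phase n) (t : ℝ) : ℝ :=
  (∫ s in (0 : ℝ)..t, shiftRate τ w v s) - t * shiftMean τ w v

/-- The closed curve `g w' + m w`, where `m` is the mean value of the shift rate. -/
noncomputable def shiftCurve (τ : ℝ) (w N v : ℝ → Phase n) (t : ℝ) : Phase n :=
  shiftAmp τ w v t • τ • J n (N t) + shiftMean τ w v • w t

/-- The velocity of the curve `g w' + m w`. -/
noncomputable def shiftVel (τ : ℝ) (w N : ℝ → Phase n) (S : ℝ → Phase n →L[ℝ] Phase n)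
    (v : ℝ → Phase n) (t : ℝ) : Phase n :=
  shiftRate τ w v t • τ • J n (N t) +
    shiftAmp τ w v t • τ • J n (S t (τ • J n (N t)))

variable {τ r R : ℝ} {w N : ℝ → Phase n} {S : ℝ → Phase n →L[ℝ] Phase n} {ψ v : ℝ → Phase n}

theorem continuous_shiftRate (h : IsFrame τ r R w N S) (hv : Continuous v) :
    Continuous (shiftRate τ w v) :=
  continuous_const.mul (h.continuous_curve.inner ((J n).continuous.comp hv))

theorem hasDerivAt_shiftAmp (h : IsFrame τ r R w N S) (hv : Continuous v) (t : ℝ) :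
    HasDerivAt (shiftAmp τ w v) (shiftRate τ w v t - shiftMean τ w v) t := by
  have hc := continuous_shiftRate h hv
  have h1 := (intervalIntegral.integral_hasDerivAt_right (hc.intervalIntegrable 0 t)
    (hc.stronglyMeasurableAtFilter _ _) hc.continuousAt).sub
    ((hasDerivAt_id t).mul_const (shiftMean τ w v))
  refine HasDerivAt.congr_deriv (f := shiftAmp τ w v) h1 ?_
  rw [one_mul]

theorem shiftAmp_zero : shiftAmp τ w v 0 = 0 := by simp [shiftAmp]

theorem shiftAmp_one : shiftAmp τ w v 1 = 0 := by simp [shiftAmp, shiftMean]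

theorem continuous_shiftVel (h : IsFrame τ r R w N S) (hv : Continuous v) :
    Continuous (shiftVel τ w N S v) := by
  have h1 := continuous_shiftRate h hv
  have h2 : Continuous (shiftAmp τ w v) :=
    continuous_iff_continuousAt.2 fun t => (hasDerivAt_shiftAmp h hv t).continuousAt
  have h3 := h.continuous_velocity
  have h4 : Continuous fun t => J n (S t (τ • J n (N t))) :=
    (J n).continuous.comp (h.continuous.clm_apply h3)
  exact (h1.smul h3).add (h2.smul (h4.const_smul τ))

theorem hasDerivAt_shiftCurve (h : IsFrame τ r R w N S) (hv : Continuous v) (t : ℝ) :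
    HasDerivAt (shiftCurve τ w N v) (shiftVel τ w N S v t) t := by
  have h1 := ((J n).hasFDerivAt.comp_hasDerivAt t (h.hasDerivAt_normal t)).const_smul τ
  have h2 := ((hasDerivAt_shiftAmp h hv t).smul h1).add
    ((h.hasDerivAt t).const_smul (shiftMean τ w v))
  refine h2.congr_deriv ?_
  simp only [shiftVel, Pi.smul_apply, Function.comp_apply]
  module

theorem shiftCurve_closed (h : IsFrame τ r R w N S) :
    shiftCurve τ w N v 1 = shiftCurve τ w N v 0 := by
  simp only [shiftCurve, shiftAmp_zero, shiftAmp_one, h.closed, zero_smul]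

theorem J_shiftVel (t : ℝ) : J n (shiftVel τ w N S v t) =
    -((τ * shiftRate τ w v t) • N t + (τ * shiftAmp τ w v t) • S t (τ • J n (N t))) := by
  simp only [shiftVel, map_add, map_smul, J_J]
  module

/-- The corrected velocity is everywhere orthogonal to `J w`, so the form does not depend on `κ`
there; it differs from the form at the original velocity by a total derivative and a
nonpositive term. -/
theorem integrand_shift (h : IsFrame τ r R w N S) (κ t : ℝ) :
    ⟪J n (v t + shiftVel τ w N S v t), ψ t + shiftCurve τ w N v t⟫_ℝ +
      ⟪J n (v t + shiftVel τ w N S v t), dualOp τ w S κ t (J n (v t + shiftVel τ w N S v t))⟫_ℝ =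
    ⟪J n (v t), ψ t⟫_ℝ + ⟪dualOp τ w S 0 t (J n (v t)), J n (v t)⟫_ℝ
      - τ * (shiftRate τ w v t ^ 2 - shiftMean τ w v * shiftRate τ w v t)
      + (⟪J n (shiftCurve τ w N v t), v t⟫_ℝ + ⟪J n (shiftVel τ w N S v t), ψ t⟫_ℝ) := by
  have hτ := h.τ_pos.ne'
  set q := τ • J n (N t) with hq
  set a := J n (v t) with ha
  set p := shiftRate τ w v t with hp
  set g := shiftAmp τ w v t with hg
  set m := shiftMean τ w v with hm
  have hwa : ⟪w t, a⟫_ℝ = τ * p := by rw [hp, shiftRate, mul_inv_cancel_left₀ hτ]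
  have hNw : ⟪N t, w t⟫_ℝ = 1 := h.inner_eq_one t
  have hNq : ⟪N t, q⟫_ℝ = 0 := by
    rw [hq, real_inner_smul_right, real_inner_comm, inner_J_self, mul_zero]
  have hSqw : ⟪S t q, w t⟫_ℝ = 0 := by rw [h.symm, h.apply_self, real_inner_comm, hNq]
  have hiN : ⟪Ring.inverse (S t) a, N t⟫_ℝ = τ * p := by
    rw [h.inverse_symm, h.inverse_normal, real_inner_comm, hwa]
  have hiS : ⟪Ring.inverse (S t) a, S t q⟫_ℝ = ⟪a, q⟫_ℝ := by
    rw [h.inverse_symm, h.inverse_apply]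
  have hJc : ⟪J n (shiftCurve τ w N v t), v t⟫_ℝ = -(g * ⟪a, q⟫_ℝ + m * (τ * p)) := by
    rw [inner_J_left, ← ha, shiftCurve, inner_add_left, ← hq, real_inner_smul_left q,
      real_inner_smul_left (w t), hwa, real_inner_comm a q]
  have hJφ : J n (v t + shiftVel τ w N S v t) = a - ((τ * p) • N t + (τ * g) • S t q) := by
    rw [map_add, J_shiftVel, sub_eq_add_neg]
  have hdual : dualOp τ w S κ t (a - ((τ * p) • N t + (τ * g) • S t q)) =
      τ⁻¹ • Ring.inverse (S t) a - (p • w t + g • q) := by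
    have h0 : ⟪w t, a - ((τ * p) • N t + (τ * g) • S t q)⟫_ℝ = 0 := by
      rw [inner_sub_right, inner_add_right, real_inner_smul_right, real_inner_smul_right, hwa,
        real_inner_comm, hNw, real_inner_comm, hSqw]
      ring
    change τ⁻¹ • (Ring.inverse (S t) _ + κ • ⟪w t, _⟫_ℝ • w t) = _
    rw [h0, map_sub, map_add, map_smul, map_smul, h.inverse_normal, h.inverse_apply]
    match_scalars
    all_goals field_simp
    ring
  rw [hJc, hJφ, hdual, J_shiftVel, shiftCurve, inner_dualOp, ← hq, ← hp, ← hg, ← hm]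
  simp only [inner_sub_left, inner_sub_right, inner_add_left, inner_add_right,
    real_inner_smul_left, real_inner_smul_right, inner_neg_left, hNw, hNq, hSqw,
    real_inner_comm (w t) a, hwa, real_inner_comm (Ring.inverse (S t) a) (N t), hiN,
    real_inner_comm (Ring.inverse (S t) a) (S t q), hiS,
    real_inner_comm (Ring.inverse (S t) a) a]
  field_simp
  ring

theorem hasDerivAt_corrected (h : IsFrame τ r R w N S) (hψ : ∀ t, HasDerivAt ψ (v t) t)
    (hv : Continuous v) (t : ℝ) :
    HasDerivAt (fun t => ψ t + shiftCurve τ w N v t) (v t + shiftVel τ w N S v t) t :=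
  (hψ t).add (hasDerivAt_shiftCurve h hv t)

theorem continuous_corrected (h : IsFrame τ r R w N S) (hv : Continuous v) :
    Continuous fun t => v t + shiftVel τ w N S v t :=
  hv.add (continuous_shiftVel h hv)

theorem corrected_closed (h : IsFrame τ r R w N S) (h1 : ψ 1 = ψ 0) :
    ψ 1 + shiftCurve τ w N v 1 = ψ 0 + shiftCurve τ w N v 0 := by
  rw [h1, shiftCurve_closed h]

/-- The correction does not increase the form, and makes it independent of `κ`. -/
theorem frameForm_corrected_le (h : IsFrame τ r R w N S) (hψ : ∀ t, HasDerivAt ψ (v t) t)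
    (hv : Continuous v) (h1 : ψ 1 = ψ 0) (κ : ℝ) :
    frameForm τ w S κ
      (velocity (hasDerivAt_corrected h hψ hv) (continuous_corrected h hv) (corrected_closed h h1))
      (velocity (hasDerivAt_corrected h hψ hv) (continuous_corrected h hv) (corrected_closed h h1))
      ≤ ∫ t in (0 : ℝ)..1,
        (⟪J n (v t), ψ t⟫_ℝ + ⟪dualOp τ w S 0 t (J n (v t)), J n (v t)⟫_ℝ) := by
  have hτ := h.τ_pos
  have hψc : Continuous ψ := continuous_iff_continuousAt.2 fun t => (hψ t).continuousAt
  have hJv : Continuous fun t => J n (v t) := (J n).continuous.comp hv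
  have hp := continuous_shiftRate h hv
  have hχ := hasDerivAt_shiftCurve h hv
  have hχc : Continuous (shiftCurve τ w N v) :=
    continuous_iff_continuousAt.2 fun t => (hχ t).continuousAt
  have hc1 : Continuous fun t =>
      ⟪J n (v t), ψ t⟫_ℝ + ⟪dualOp τ w S 0 t (J n (v t)), J n (v t)⟫_ℝ :=
    (hJv.inner hψc).add (((h.continuous_dualOp 0).clm_apply hJv).inner hJv)
  have hc2 : Continuous fun t =>
      τ * (shiftRate τ w v t ^ 2 - shiftMean τ w v * shiftRate τ w v t) := by fun_prop
  have hc3 : Continuous fun t =>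
      ⟪J n (shiftCurve τ w N v t), v t⟫_ℝ + ⟪J n (shiftVel τ w N S v t), ψ t⟫_ℝ :=
    (((J n).continuous.comp hχc).inner hv).add
      (((J n).continuous.comp (continuous_shiftVel h hv)).inner hψc)
  have hc12 : Continuous fun t =>
      (⟪J n (v t), ψ t⟫_ℝ + ⟪dualOp τ w S 0 t (J n (v t)), J n (v t)⟫_ℝ) -
        τ * (shiftRate τ w v t ^ 2 - shiftMean τ w v * shiftRate τ w v t) := hc1.sub hc2
  have hD : ∫ t in (0 : ℝ)..1,
      (⟪J n (shiftCurve τ w N v t), v t⟫_ℝ + ⟪J n (shiftVel τ w N S v t), ψ t⟫_ℝ) = 0 := by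
    have hd : ∀ t, HasDerivAt (fun t => ⟪J n (shiftCurve τ w N v t), ψ t⟫_ℝ)
        (⟪J n (shiftCurve τ w N v t), v t⟫_ℝ + ⟪J n (shiftVel τ w N S v t), ψ t⟫_ℝ) t := fun t =>
      ((J n).hasFDerivAt.comp_hasDerivAt t (hχ t)).inner ℝ (hψ t)
    rw [intervalIntegral.integral_eq_sub_of_hasDerivAt (fun t _ => hd t)
      (hc3.intervalIntegrable _ _), h1, shiftCurve_closed h, sub_self]
  -- the variance of the shift rate
  have hvar : 0 ≤ ∫ t in (0 : ℝ)..1,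
      τ * (shiftRate τ w v t ^ 2 - shiftMean τ w v * shiftRate τ w v t) := by
    set m := shiftMean τ w v with hm
    have h2 : ∫ t in (0 : ℝ)..1, (shiftRate τ w v t ^ 2 - m * shiftRate τ w v t) =
        ∫ t in (0 : ℝ)..1, (shiftRate τ w v t - m) ^ 2 := by
      have h3 : ∀ t, (shiftRate τ w v t - m) ^ 2 =
          (shiftRate τ w v t ^ 2 - m * shiftRate τ w v t) - (m * shiftRate τ w v t - m ^ 2) :=
        fun t => by ring
      have h4 : ∫ t in (0 : ℝ)..1, (m * shiftRate τ w v t - m ^ 2) = 0 := by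
        rw [intervalIntegral.integral_sub ((hp.const_mul m).intervalIntegrable _ _)
          intervalIntegrable_const, intervalIntegral.integral_const_mul]
        change m * m - _ = 0
        simp
        ring
      simp only [h3]
      rw [intervalIntegral.integral_sub
        (f := fun t => shiftRate τ w v t ^ 2 - m * shiftRate τ w v t)
        (g := fun t => m * shiftRate τ w v t - m ^ 2)
        (Continuous.intervalIntegrable (by fun_prop) _ _)
        (Continuous.intervalIntegrable (by fun_prop) _ _), h4, sub_zero]
    rw [intervalIntegral.integral_const_mul, h2]
    exact mul_nonneg hτ.le
      (intervalIntegral.integral_nonneg zero_le_one fun t _ => sq_nonneg _)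
  rw [frameForm_velocity h]
  have heq : ∫ t in (0 : ℝ)..1, (⟪J n ((velocity (hasDerivAt_corrected h hψ hv)
        (continuous_corrected h hv) (corrected_closed h h1) : L2 n) t),
        ψ t + shiftCurve τ w N v t⟫_ℝ +
      ⟪J n ((velocity (hasDerivAt_corrected h hψ hv)
        (continuous_corrected h hv) (corrected_closed h h1) : L2 n) t),
        dualOp τ w S κ t (J n (v t + shiftVel τ w N S v t))⟫_ℝ) =
      ∫ t in (0 : ℝ)..1,
        ((⟪J n (v t), ψ t⟫_ℝ + ⟪dualOp τ w S 0 t (J n (v t)), J n (v t)⟫_ℝ)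
      - τ * (shiftRate τ w v t ^ 2 - shiftMean τ w v * shiftRate τ w v t)
      + (⟪J n (shiftCurve τ w N v t), v t⟫_ℝ + ⟪J n (shiftVel τ w N S v t), ψ t⟫_ℝ)) := by
    refine intervalIntegral.integral_congr_ae_restrict ?_
    rw [uIoc_of_le zero_le_one]
    filter_upwards [coe_velocity (hasDerivAt_corrected h hψ hv) (continuous_corrected h hv)
      (corrected_closed h h1)] with t ht
    rw [ht, integrand_shift h]
  rw [heq, intervalIntegral.integral_add (hc12.intervalIntegrable _ _)
    (hc3.intervalIntegrable _ _), hD, add_zero,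
    intervalIntegral.integral_sub (hc1.intervalIntegrable _ _) (hc2.intervalIntegrable _ _)]
  linarith

theorem shiftRate_add (u v : ℝ → Phase n) (t : ℝ) :
    shiftRate τ w (fun t => u t + v t) t = shiftRate τ w u t + shiftRate τ w v t := by
  simp only [shiftRate, map_add, inner_add_right, mul_add]

theorem shiftRate_smul (c : ℝ) (v : ℝ → Phase n) (t : ℝ) :
    shiftRate τ w (fun t => c • v t) t = c * shiftRate τ w v t := by
  simp only [shiftRate, map_smul, real_inner_smul_right]
  ring

theorem shiftAmp_add (h : IsFrame τ r R w N S) {u v : ℝ → Phase n} (hu : Continuous u)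
    (hv : Continuous v) (t : ℝ) :
    shiftAmp τ w (fun t => u t + v t) t = shiftAmp τ w u t + shiftAmp τ w v t := by
  have hi := fun a => intervalIntegral.integral_add (μ := volume)
    ((continuous_shiftRate h hu).intervalIntegrable 0 a)
    ((continuous_shiftRate h hv).intervalIntegrable 0 a)
  simp only [shiftAmp, shiftMean, shiftRate_add, hi]
  ring

theorem shiftAmp_smul (c : ℝ) (v : ℝ → Phase n) (t : ℝ) :
    shiftAmp τ w (fun t => c • v t) t = c * shiftAmp τ w v t := by
  simp only [shiftAmp, shiftMean, shiftRate_smul, intervalIntegral.integral_const_mul]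
  ring

variable {k : ℕ}

theorem trigPoly_add (ξ η : Fin k → Phase n) :
    trigPoly (ξ + η) = fun t => trigPoly ξ t + trigPoly η t := by
  funext t
  simp only [trigPoly, Pi.add_apply, rot_add, Finset.sum_add_distrib]

theorem trigPoly_smul (c : ℝ) (ξ : Fin k → Phase n) :
    trigPoly (c • ξ) = fun t => c • trigPoly ξ t := by
  funext t
  simp only [trigPoly, Pi.smul_apply, rot_smul, Finset.smul_sum]

/-- The corrected trigonometric polynomials, as a linear family of loops. -/
noncomputable def correctedTrig (h : IsFrame τ r R w N S) (k : ℕ) :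
    (Fin k → Phase n) →ₗ[ℝ] L20 n where
  toFun ξ := velocity (hasDerivAt_corrected h (hasDerivAt_trigPrim ξ) (continuous_trigPoly ξ))
    (continuous_corrected h (continuous_trigPoly ξ)) (corrected_closed h (trigPrim_closed ξ))
  map_add' ξ η := by
    refine Subtype.ext (Lp.ext ?_)
    refine (coe_velocity _ _ _).trans (Filter.EventuallyEq.trans ?_ (Lp.coeFn_add _ _).symm)
    filter_upwards [coe_velocity (hasDerivAt_corrected h (hasDerivAt_trigPrim ξ)
        (continuous_trigPoly ξ)) (continuous_corrected h (continuous_trigPoly ξ))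
        (corrected_closed h (trigPrim_closed ξ)),
      coe_velocity (hasDerivAt_corrected h (hasDerivAt_trigPrim η) (continuous_trigPoly η))
        (continuous_corrected h (continuous_trigPoly η)) (corrected_closed h (trigPrim_closed η))]
      with t h1 h2
    rw [Pi.add_apply, h1, h2, trigPoly_add]
    simp only [shiftVel, shiftRate_add,
      shiftAmp_add h (continuous_trigPoly ξ) (continuous_trigPoly η)]
    module
  map_smul' c ξ := by
    refine Subtype.ext (Lp.ext ?_)
    refine (coe_velocity _ _ _).trans (Filter.EventuallyEq.trans ?_ (Lp.coeFn_smul _ _).symm)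
    filter_upwards [coe_velocity (hasDerivAt_corrected h (hasDerivAt_trigPrim ξ)
        (continuous_trigPoly ξ)) (continuous_corrected h (continuous_trigPoly ξ))
        (corrected_closed h (trigPrim_closed ξ))] with t h1
    rw [Pi.smul_apply, h1, trigPoly_smul]
    simp only [shiftVel, shiftRate_smul, shiftAmp_smul, RingHom.id_apply]
    module

theorem frameForm_correctedTrig_neg (h : IsFrame τ r R w N S) (κ : ℝ)
    (hk : k * Real.pi * R ^ 2 < τ / 2) {ξ : Fin k → Phase n} (hξ : ξ ≠ 0) :
    frameForm τ w S κ (correctedTrig h k ξ) (correctedTrig h k ξ) < 0 := by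
  have hτ := h.τ_pos
  have hv := continuous_trigPoly ξ
  have hψ := hasDerivAt_trigPrim ξ
  have hψc : Continuous (trigPrim ξ) := continuous_iff_continuousAt.2 fun t => (hψ t).continuousAt
  have hJv : Continuous fun t => J n (trigPoly ξ t) := (J n).continuous.comp hv
  refine (frameForm_corrected_le h hψ hv (trigPrim_closed ξ) κ).trans_lt ?_
  refine lt_of_le_of_lt ?_ (integral_trigPoly_neg (b := R ^ 2 / τ) (k := k) ?_ hξ)
  · refine intervalIntegral.integral_mono_on zero_le_one (Continuous.intervalIntegrable
      ((hJv.inner hψc).add (((h.continuous_dualOp 0).clm_apply hJv).inner hJv)) _ _)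
      (Continuous.intervalIntegrable ((hJv.inner hψc).add ((hv.inner hv).const_mul _)) _ _)
      fun t _ => ?_
    have h1 := h.inverse_le t (J n (trigPoly ξ t))
    rw [← real_inner_self_eq_norm_sq, inner_J_J] at h1
    rw [inner_dualOp, zero_mul, add_zero, div_mul_eq_mul_div, div_eq_inv_mul]
    gcongr
  · rw [div_mul_eq_mul_div, div_lt_one hτ]
    linarith

/-- The lower bound for the index. -/
theorem IsFrame.le_formIndex (h : IsFrame τ r R w N S) (κ : ℝ)
    (hk : k * Real.pi * R ^ 2 < τ / 2) :
    ((2 * n * k : ℕ) : ℕ∞) ≤ formIndex (frameForm τ w S κ) := by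
  have hneg := fun ξ : Fin k → Phase n => frameForm_correctedTrig_neg h κ hk (ξ := ξ)
  have hinj : Function.Injective (correctedTrig h k) := by
    refine (injective_iff_map_eq_zero _).2 fun ξ hξ => ?_
    by_contra hne
    have h1 := hneg ξ hne
    have h2 := h.frameForm_smul_left κ 0 0 0
    rw [zero_smul, zero_mul] at h2
    rw [hξ, h2] at h1
    exact lt_irrefl _ h1
  have hrank : Module.rank ℝ (LinearMap.range (correctedTrig h k)) = ((2 * n * k : ℕ) : Cardinal) := by
    rw [← Module.finrank_eq_rank, LinearMap.finrank_range_of_inj hinj, Module.finrank_pi_fintype]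
    simp
    ring
  rw [← Cardinal.toENat_nat, ← hrank]
  refine le_iSup₂ (f := fun (V : Submodule ℝ (L20 n))
    (_ : ∀ v ∈ V, v ≠ 0 → frameForm τ w S κ v v < 0) => Cardinal.toENat (Module.rank ℝ V)) _ ?_
  rintro _ ⟨ξ, rfl⟩ hne
  exact hneg ξ fun h0 => hne (by rw [h0, map_zero])

end Shift

/-! ### The dual Hessian of a closed characteristic -/

variable {U : Set (Phase n)} {r R τ α : ℝ} {y : ℝ → Phase n}

/-- The normalisation `N · y = 1` makes the action half of the period. -/
theorem action_eq (hy : IsClosedChar U τ y) : action τ y = τ / 2 := by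
  have h : ∀ t, ⟪J n (y t), deriv y t⟫_ℝ = 1 := fun t => by
    obtain ⟨N, hN, hd⟩ := hy.eqn t
    rw [hd.deriv, inner_J_J, real_inner_comm, hN.2]
  rw [action]
  simp only [h]
  simp
  ring

/-- Along the associated solution the dual Hessian is the form of the linearised flow. -/
theorem dualHess_eq {N : ℝ → Phase n} (hU : IsPinched U r R) (hy : IsClosedChar U τ y)
    (hN : ∀ t, IsOutwardNormal U (y (τ * t)) (N t))
    (h : IsFrame τ r R (fun t => y (τ * t)) N (fun t => hessMap U (y (τ * t))))
    (hα : α ∈ Ioo (1 : ℝ) 2) {x : ℝ → Phase n} (hx : IsAssociatedSol U α τ y x) :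
    dualHess U α (deriv x) = frameForm τ (fun t => y (τ * t)) (fun t => hessMap U (y (τ * t)))
      ((2 - α) / (α - 1)) := by
  funext v z
  rw [h.frameForm_eq_integral, dualHess]
  simp only [hess_fenchel_ham hU hy hN h hα hx, inner_dualOp]

end ClosedChar

theorem lemma4p1 {n : ℕ} {r R : ℝ} (U : Set (ClosedChar.Phase n))
    (hU : ClosedChar.IsPinched U r R)
    (τ : ℝ) (y : ℝ → ClosedChar.Phase n) (hy : ClosedChar.IsClosedChar U τ y)
    (α : ℝ) (hα : α ∈ Set.Ioo (1 : ℝ) 2) :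
    (∃! x : ℝ → ClosedChar.Phase n, ClosedChar.IsAssociatedSol U α τ y x) ∧
    ∀ x : ℝ → ClosedChar.Phase n, ClosedChar.IsAssociatedSol U α τ y x →
      ∃ i ν : ℕ,
        ClosedChar.formIndex (ClosedChar.dualHess U α (deriv x)) = i ∧
        ClosedChar.formNullity (ClosedChar.dualHess U α (deriv x)) = ν ∧
        ∀ k : ℤ,
          ((k : ℝ) * Real.pi * R ^ 2 < ClosedChar.action τ y → 2 * (n : ℤ) * k ≤ i) ∧
          (ClosedChar.action τ y < (k : ℝ) * Real.pi * r ^ 2 →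
            (i : ℤ) + ν ≤ 2 * (n : ℤ) * (k - 1) - 1) := by
  obtain ⟨N, hN, h⟩ := hy.exists_isFrame hU
  refine ⟨⟨_, (ClosedChar.isAssociatedSol_iff hU hy hN h hα _).2 rfl,
    fun x hx => (ClosedChar.isAssociatedSol_iff hU hy hN h hα x).1 hx⟩, fun x hx => ?_⟩
  rw [ClosedChar.dualHess_eq hU hy hN h hα hx, ClosedChar.action_eq hy]
  have hκ : 0 < (2 - α) / (α - 1) := div_pos (by linarith [hα.2]) (by linarith [hα.1])
  have hr : 0 < Real.pi * r ^ 2 := mul_pos Real.pi_pos (pow_pos h.r_pos 2)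
  -- for a large mode number the action condition of the upper bound holds, so the index is finite
  obtain ⟨K, hK⟩ := exists_nat_gt (τ / 2 / (Real.pi * r ^ 2))
  rw [div_lt_iff₀ hr] at hK
  obtain ⟨i, ν, hi, hν, -⟩ := h.exists_index_nullity hκ (K := K) (by nlinarith)
  refine ⟨i, ν, hi, hν, fun k => ⟨fun hk => ?_, fun hk => ?_⟩⟩
  · rcases le_or_gt k 0 with hk0 | hk0
    · have : 2 * (n : ℤ) * k ≤ 0 := mul_nonpos_of_nonneg_of_nonpos (by positivity) hk0
      omega
    · lift k to ℕ using hk0.le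
      have h1 := h.le_formIndex ((2 - α) / (α - 1)) (k := k) (by exact_mod_cast hk)
      rw [hi] at h1
      exact_mod_cast h1
  · have hk0 : 0 < k := by
      by_contra hcon
      push Not at hcon
      have h1 : (k : ℝ) ≤ 0 := by exact_mod_cast hcon
      have h2 : (k : ℝ) * Real.pi * r ^ 2 ≤ 0 := by
        rw [mul_assoc]
        exact mul_nonpos_of_nonpos_of_nonneg h1 hr.le
      linarith [h.τ_pos]
    obtain ⟨K', rfl⟩ : ∃ K' : ℕ, k = K' + 1 := ⟨(k - 1).toNat, by omega⟩
    obtain ⟨i', ν', hi', hν', hle⟩ := h.exists_index_nullity hκ (K := K') (by exact_mod_cast hk)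
    have e1 : i = i' := by exact_mod_cast hi.symm.trans hi'
    have e2 : ν = ν' := by exact_mod_cast hν.symm.trans hν'
    subst e1 e2
    have h1 : (i : ℤ) + ν + 1 ≤ 2 * n * K' := by exact_mod_cast hle
    rw [add_sub_cancel_right]
    linarith
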